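/- Let $\Sigma$ be one of the round sphere $\mathbb S^2$, the Euclidean plane $\mathbb R^2$, the hyperbolic plane $\mathbb H^2$ (Gaussian curvature $1,0,-1$), with metric $g$ and Levi-Civita connection $\nabla$. Let $a<b$, $I=[a,b]$, $A,B\in\Sigma$, and let $F:I\times[0,\infty)\to\Sigma$ be continuous on $I\times[0,\infty)$, smooth on $I\times(0,\infty)$ (up to the endpoints of $I$), with $\partial_uF\neq0$ for $t>0$. Put $v=\langle\partial_uF,\partial_uF\rangle_g^{1/2}$, $\partial_s=v^{-1}\partial_u$, $T=\partial_sF$ and $K=\nabla_TT$. Suppose that $F$ is a solution, existing for all time, of the Dirichlet problem for the curve shortening flow: $$\partial_tF=K\quad\text{on } I\times(0,\infty),\qquad F(a,t)=A,\quad F(b,t)=B\quad\text{for all } t\ge0 .$$ For each $t>0$ let $N(\cdot,t)$ be a continuous unit normal vector field along $F(\cdot,t)$ (tangent to $\Sigma$), and let $\kappa=\langle K,N\rangle_g$. Then $\kappa$ and all of its arclength derivatives tend to zero as $t\to\infty$, at every point and in fact uniformly on the curve: for every integer $n\ge0$, $$\lim_{t\to\infty}\ \sup_{u\in I}\bigl|\partial_s^n\kappa(u,t)\bigr|=0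 .$$ -/

import Mathlib

open Set Filter Topology
open scoped ContDiff

noncomputable section

namespace DirichletCSF

/-- The three complete simply connected surfaces of constant Gaussian curvature `1`, `0`, `-1`,
each realised as a surface in a three-dimensional (Euclidean or Minkowski) space. -/
inductive SpaceForm
  | sphere
  | plane
  | hyperbolic

namespace SpaceForm

/-- The ambient scalar product on `ℝ³`: the Euclidean one for the sphere and the plane, and the
Minkowski one `-x₀y₀ + x₁y₁ + x₂y₂` for the hyperbolic plane. The Riemannian metric `g` of the
surface is its restriction to the tangent planes. -/
def form : SpaceForm → (Fin 3 → ℝ) → (Fin 3 → ℝ) → ℝ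
  | sphere, x, y => x 0 * y 0 + x 1 * y 1 + x 2 * y 2
  | plane, x, y => x 0 * y 0 + x 1 * y 1 + x 2 * y 2
  | hyperbolic, x, y => -(x 0 * y 0) + x 1 * y 1 + x 2 * y 2

/-- The points of the surface `Σ`: the unit sphere, the plane `x₀ = 0`, or the upper sheet
`-x₀² + x₁² + x₂² = -1`, `x₀ > 0` of the hyperboloid. -/
def carrier : SpaceForm → Set (Fin 3 → ℝ)
  | sphere => {x | x 0 ^ 2 + x 1 ^ 2 + x 2 ^ 2 = 1}
  | plane => {x | x 0 = 0}
  | hyperbolic => {x | -(x 0 ^ 2) + x 1 ^ 2 + x 2 ^ 2 = -1 ∧ 0 < x 0}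

/-- The normal vector, with respect to `form`, of the surface in the ambient space at `x`. -/
def normal : SpaceForm → (Fin 3 → ℝ) → (Fin 3 → ℝ)
  | sphere, x => x
  | plane, _ => ![1, 0, 0]
  | hyperbolic, x => x

/-- Orthogonal projection, with respect to `form`, of an ambient vector `w` to the tangent plane
of the surface at `x`. -/
def tangentProj (M : SpaceForm) (x w : Fin 3 → ℝ) : Fin 3 → ℝ :=
  w - (M.form w (M.normal x) / M.form (M.normal x) (M.normal x)) • M.normal x

end SpaceForm

/-! For a family of curves `F : [a, b] × [0, ∞) → Σ`, written `F u t`, the geometry of the curve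
`F(·, t)`. Derivatives in `u` are derivatives within `[a, b]` (one-sided at the endpoints). -/

/-- `∂F/∂u`. -/
def velocity (a b : ℝ) (F : ℝ → ℝ → Fin 3 → ℝ) (t u : ℝ) : Fin 3 → ℝ :=
  derivWithin (fun x => F x t) (Icc a b) u

/-- The speed `v = ⟨∂F/∂u, ∂F/∂u⟩^{1/2}`, so that `ds = v du`. -/
def speed (M : SpaceForm) (a b : ℝ) (F : ℝ → ℝ → Fin 3 → ℝ) (t u : ℝ) : ℝ :=
  Real.sqrt (M.form (velocity a b F t u) (velocity a b F t u))

/-- The unit tangent vector `T = v⁻¹ ∂F/∂u`. -/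
def unitTangent (M : SpaceForm) (a b : ℝ) (F : ℝ → ℝ → Fin 3 → ℝ) (t u : ℝ) : Fin 3 → ℝ :=
  (speed M a b F t u)⁻¹ • velocity a b F t u

/-- The curvature vector `K = ∇_T T`. The Levi-Civita derivative of `Σ` along the curve is the
tangential projection of the ambient derivative. -/
def curvatureVector (M : SpaceForm) (a b : ℝ) (F : ℝ → ℝ → Fin 3 → ℝ) (t u : ℝ) : Fin 3 → ℝ :=
  M.tangentProj (F u t)
    ((speed M a b F t u)⁻¹ • derivWithin (unitTangent M a b F t) (Icc a b) u)

/-- The arclength derivative `∂f/∂s = v⁻¹ ∂f/∂u` of a function `f` along `F(·, t)`. -/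
def arcDeriv (M : SpaceForm) (a b : ℝ) (F : ℝ → ℝ → Fin 3 → ℝ) (t : ℝ) (f : ℝ → ℝ) (u : ℝ) : ℝ :=
  (speed M a b F t u)⁻¹ * derivWithin f (Icc a b) u

/-- `F` is a solution, existing for all times `t ∈ [0, ∞)`, of the curve shortening flow
`∂F/∂t = K` on the surface `M` with `F(a, t) = A` and `F(b, t) = B`: continuous up to `t = 0`,
smooth and immersed for `t > 0`. -/
structure IsGlobalSolution (M : SpaceForm) (a b : ℝ) (A B : Fin 3 → ℝ)
    (F : ℝ → ℝ → Fin 3 → ℝ) : Prop where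
  mem_carrier : ∀ u ∈ Icc a b, ∀ t, 0 ≤ t → F u t ∈ M.carrier
  continuousOn : ContinuousOn (fun p : ℝ × ℝ => F p.1 p.2) (Icc a b ×ˢ Ici 0)
  smooth : ContDiffOn ℝ ∞ (fun p : ℝ × ℝ => F p.1 p.2) (Icc a b ×ˢ Ioi 0)
  immersed : ∀ u ∈ Icc a b, ∀ t, 0 < t → velocity a b F t u ≠ 0
  flow : ∀ u ∈ Icc a b, ∀ t, 0 < t → HasDerivAt (fun τ => F u τ) (curvatureVector M a b F t u) t
  left_endpoint : ∀ t, 0 ≤ t → F a t = A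
  right_endpoint : ∀ t, 0 ≤ t → F b t = B

/-- `N` is a choice of unit normal vector field, tangent to `Σ`, along each of the curves
`F(·, t)`, `t > 0`. -/
structure IsUnitNormal (M : SpaceForm) (a b : ℝ) (F N : ℝ → ℝ → Fin 3 → ℝ) : Prop where
  continuousOn : ∀ t, 0 < t → ContinuousOn (fun u => N u t) (Icc a b)
  tangent : ∀ u ∈ Icc a b, ∀ t, 0 < t → M.form (N u t) (M.normal (F u t)) = 0
  unit : ∀ u ∈ Icc a b, ∀ t, 0 < t → M.form (N u t) (N u t) = 1
  orthogonal : ∀ u ∈ Icc a b, ∀ t, 0 < t → M.form (N u t) (velocity a b F t u) = 0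

/-- The scalar curvature `κ = ⟨K, N⟩` of `F(·, t)` with respect to the unit normal `N`. -/
def curvature (M : SpaceForm) (a b : ℝ) (F N : ℝ → ℝ → Fin 3 → ℝ) (t u : ℝ) : ℝ :=
  M.form (curvatureVector M a b F t u) (N u t)

end DirichletCSF

end

/-! Write `k n` for the `n`-th arclength derivative of the curvature, `L` for the length and `E n`
for the integral of `(k n)²` in arclength. In a moving frame the flow becomes a scalar system for
speed and curvature (`CurvatureFlow`), with `G` the Gaussian curvature: `∂ₜv = -κ²v` and `∂ₜκ = κₛₛ
+ Gκ + κ³`, with `κ = 0` at the ends because the endpoints do not move. Hence `∂ₜ(k n) = k (n+2) + G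
k n +` cubic terms of total order `n` (`dt_curvDeriv`).

At a fixed end this equation forces all even derivatives of the curvature to vanish. So integration
by parts leaves no boundary term, and every `k n` has a zero on the curve, for odd `n` by Rolle. As
`L` does not increase, Cauchy-Schwarz from such a zero gives `sup |k n|² ≤ L · E (n+1)` and a
Poincaré inequality with a constant uniform in time. The cubic terms can then be absorbed: `(E n)' ≤
-E (n+1) + C (E n + (E n)³)` (`exists_deriv_energy_le`).

The decay is a bootstrap. Start from `L' = -E 0` with `L ≥ 0`. If some functional `P` bounded below
satisfies `P' ≤ -E n`, then `E n` is integrable in time, and the bound on its growth forces `E n →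
0` (`tendsto_zero_of_dissipation`). Once `E n < 1`, the functional `E n + 2CP` dissipates `E (n+1)`
(`exists_dissipation`). Thus every energy tends to zero, and the sup bound makes the convergence of
`k n` uniform. No limit curve and no positive lower bound on the length is needed. -/

namespace DirichletCSF

/-! ### Partial derivatives on the strip, up to its lateral boundary. -/

section Calculus

variable {E : Type*} [NormedAddCommGroup E] [NormedSpace ℝ E]

/-- The space-time strip `[a, b] × (0, ∞)`. -/
def strip (a b : ℝ) : Set (ℝ × ℝ) := Icc a b ×ˢ Ioi 0

theorem mem_strip {a b u t : ℝ} : (u, t) ∈ strip a b ↔ u ∈ Icc a b ∧ 0 < t := Iff.rfl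

/-- The partial derivative in the first variable on the strip. -/
noncomputable def Du (a b : ℝ) (f : ℝ × ℝ → E) (p : ℝ × ℝ) : E :=
  fderivWithin ℝ f (strip a b) p (1, 0)

/-- The partial derivative in the second variable on the strip. -/
noncomputable def Dt (a b : ℝ) (f : ℝ × ℝ → E) (p : ℝ × ℝ) : E :=
  fderivWithin ℝ f (strip a b) p (0, 1)

/-- Smooth functions on the strip, up to the lateral boundary. -/
def SmoothOn (a b : ℝ) (f : ℝ × ℝ → E) : Prop := ContDiffOn ℝ ∞ f (strip a b)

variable {a b : ℝ} {f g : ℝ × ℝ → E}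

theorem uniqueDiffOn_strip (hab : a < b) : UniqueDiffOn ℝ (strip a b) :=
  (uniqueDiffOn_Icc hab).prod (uniqueDiffOn_Ioi 0)

theorem SmoothOn.du (hab : a < b) (hf : SmoothOn a b f) : SmoothOn a b (Du a b f) :=
  (hf.fderivWithin (uniqueDiffOn_strip hab) (m := ∞) (by simp)).clm_apply contDiffOn_const

theorem SmoothOn.dt (hab : a < b) (hf : SmoothOn a b f) : SmoothOn a b (Dt a b f) :=
  (hf.fderivWithin (uniqueDiffOn_strip hab) (m := ∞) (by simp)).clm_apply contDiffOn_const

theorem SmoothOn.differentiableWithinAt (hf : SmoothOn a b f) {p : ℝ × ℝ} (hp : p ∈ strip a b) :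
    DifferentiableWithinAt ℝ f (strip a b) p :=
  (hf p hp).differentiableWithinAt (by simp)

theorem SmoothOn.hasDerivWithinAt_du (hf : SmoothOn a b f) {u t : ℝ} (hu : u ∈ Icc a b)
    (ht : 0 < t) : HasDerivWithinAt (fun x => f (x, t)) (Du a b f (u, t)) (Icc a b) u := by
  have h1 := (hf.differentiableWithinAt (mem_strip.2 ⟨hu, ht⟩)).hasFDerivWithinAt
  have h2 : HasDerivWithinAt (fun x : ℝ => (x, t)) ((1 : ℝ), (0 : ℝ)) (Icc a b) u :=
    (hasDerivWithinAt_id u _).prodMk (hasDerivWithinAt_const u _ t)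
  exact h1.comp_hasDerivWithinAt u h2 (fun x hx => mem_strip.2 ⟨hx, ht⟩)

theorem SmoothOn.hasDerivAt_dt (hf : SmoothOn a b f) {u t : ℝ} (hu : u ∈ Icc a b)
    (ht : 0 < t) : HasDerivAt (fun τ => f (u, τ)) (Dt a b f (u, t)) t := by
  have h1 := (hf.differentiableWithinAt (mem_strip.2 ⟨hu, ht⟩)).hasFDerivWithinAt
  have h2 : HasDerivWithinAt (fun x : ℝ => (u, x)) ((0 : ℝ), (1 : ℝ)) (Ioi 0) t :=
    (hasDerivWithinAt_const t _ u).prodMk (hasDerivWithinAt_id t _)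
  exact (h1.comp_hasDerivWithinAt t h2 (fun x hx => mem_strip.2 ⟨hu, hx⟩)).hasDerivAt
    (Ioi_mem_nhds ht)

theorem SmoothOn.du_eq (hab : a < b) (hf : SmoothOn a b f) {u t : ℝ} (hu : u ∈ Icc a b)
    (ht : 0 < t) {f' : E} (h : HasDerivWithinAt (fun x => f (x, t)) f' (Icc a b) u) :
    Du a b f (u, t) = f' :=
  (uniqueDiffOn_Icc hab u hu).eq_deriv _ (hf.hasDerivWithinAt_du hu ht) h

theorem SmoothOn.dt_eq (hf : SmoothOn a b f) {u t : ℝ} (hu : u ∈ Icc a b)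
    (ht : 0 < t) {f' : E} (h : HasDerivAt (fun τ => f (u, τ)) f' t) :
    Dt a b f (u, t) = f' :=
  (hf.hasDerivAt_dt hu ht).unique h

theorem du_congr (h : EqOn f g (strip a b)) {p : ℝ × ℝ} (hp : p ∈ strip a b) :
    Du a b f p = Du a b g p := by
  unfold Du; rw [fderivWithin_congr h (h hp)]

theorem dt_congr (h : EqOn f g (strip a b)) {p : ℝ × ℝ} (hp : p ∈ strip a b) :
    Dt a b f p = Dt a b g p := by
  unfold Dt; rw [fderivWithin_congr h (h hp)]

/-- Symmetry of second derivatives within a set needs this at the lateral boundary, where points are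
not interior. -/
theorem strip_subset_closure_interior (hab : a < b) :
    strip a b ⊆ closure (interior (strip a b)) := by
  unfold strip
  rw [interior_prod_eq, closure_prod_eq, interior_Icc, closure_Ioo hab.ne, interior_Ioi,
    closure_Ioi]
  exact prod_mono_right Ioi_subset_Ici_self

theorem SmoothOn.du_dt (hab : a < b) (hf : SmoothOn a b f) {p : ℝ × ℝ} (hp : p ∈ strip a b) :
    Du a b (Dt a b f) p = Dt a b (Du a b f) p := by
  have hs := uniqueDiffOn_strip hab
  have h1 : DifferentiableWithinAt ℝ (fderivWithin ℝ f (strip a b)) (strip a b) p :=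
    ((hf.fderivWithin hs (m := ∞) (by simp)) p hp).differentiableWithinAt (by simp)
  have key : ∀ v w : ℝ × ℝ, fderivWithin ℝ (fun q => fderivWithin ℝ f (strip a b) q v)
      (strip a b) p w = fderivWithin ℝ (fderivWithin ℝ f (strip a b)) (strip a b) p w v := by
    intro v w
    rw [fderivWithin_clm_apply (hs p hp) h1 (differentiableWithinAt_const v)]
    simp
  have hsym := (hf p hp).isSymmSndFDerivWithinAt (n := ∞)
    (by rw [minSmoothness_of_isRCLikeNormedField]; exact WithTop.coe_le_coe.2 le_top) hs
    (strip_subset_closure_interior hab hp) hp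
  unfold Du Dt
  rw [key, key, hsym.eq]

theorem SmoothOn.continuousOn_slice (hf : SmoothOn a b f) {t : ℝ} (ht : 0 < t) :
    ContinuousOn (fun u => f (u, t)) (Icc a b) :=
  fun _ hu => (hf.hasDerivWithinAt_du hu ht).continuousWithinAt

theorem SmoothOn.intervalIntegrable (hf : SmoothOn a b f) (hab : a < b) {t : ℝ}
    (ht : 0 < t) : IntervalIntegrable (fun u => f (u, t)) MeasureTheory.volume a b :=
  ContinuousOn.intervalIntegrable (by rw [uIcc_of_le hab.le]; exact hf.continuousOn_slice ht)

/-- Dominated convergence: the time derivative is bounded on the compact box `[a, b] × [t/2, 2t]`,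
which stays away from time zero. -/
theorem SmoothOn.hasDerivAt_integral (hab : a < b) (hf : SmoothOn a b f)
    {t : ℝ} (ht : 0 < t) :
    HasDerivAt (fun τ => ∫ u in a..b, f (u, τ)) (∫ u in a..b, Dt a b f (u, t)) t := by
  have hK : IsCompact (Icc a b ×ˢ Icc (t / 2) (2 * t)) := isCompact_Icc.prod isCompact_Icc
  have hsub : Icc a b ×ˢ Icc (t / 2) (2 * t) ⊆ strip a b := fun p hp =>
    mem_strip.2 ⟨hp.1, lt_of_lt_of_le (by positivity) hp.2.1⟩
  obtain ⟨C, hC⟩ := hK.exists_bound_of_continuousOn ((hf.dt hab).continuousOn.mono hsub)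
  have hs : Icc (t / 2) (2 * t) ∈ 𝓝 t := Icc_mem_nhds (by linarith) (by linarith)
  have hIoc : ∀ u ∈ uIoc a b, u ∈ Icc a b := fun u hu => by
    rw [uIoc_of_le hab.le] at hu; exact Ioc_subset_Icc_self hu
  refine (intervalIntegral.hasDerivAt_integral_of_dominated_loc_of_deriv_le (𝕜 := ℝ)
    (F := fun τ u => f (u, τ)) (F' := fun τ u => Dt a b f (u, τ)) (bound := fun _ => C)
    hs ?_ (hf.intervalIntegrable hab ht) ?_ ?_ intervalIntegrable_const ?_).2
  · filter_upwards [Ioi_mem_nhds ht] with τ hτ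
    exact (hf.intervalIntegrable hab hτ).def'.aestronglyMeasurable
  · exact ((hf.dt hab).intervalIntegrable hab ht).def'.aestronglyMeasurable
  · exact Eventually.of_forall fun u hu τ hτ => hC (u, τ) ⟨hIoc u hu, hτ⟩
  · exact Eventually.of_forall fun u hu τ hτ =>
      hf.hasDerivAt_dt (hIoc u hu) (lt_of_lt_of_le (by positivity) hτ.1)

/-- The fundamental theorem of calculus for slices of a smooth function on the strip. -/
theorem SmoothOn.integral_du [CompleteSpace E] (hab : a < b) (hf : SmoothOn a b f) {t x y : ℝ}
    (ht : 0 < t) (hx : x ∈ Icc a b) (hy : y ∈ Icc a b) :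
    ∫ u in x..y, Du a b f (u, t) = f (y, t) - f (x, t) := by
  have hsub : uIcc x y ⊆ Icc a b := uIcc_subset_Icc hx hy
  refine intervalIntegral.integral_eq_sub_of_hasDeriv_right
    ((hf.continuousOn_slice ht).mono hsub) (fun u hu => ?_)
    (((hf.du hab).continuousOn_slice ht).mono hsub).intervalIntegrable
  have hu1 : u ∈ Ioo a b :=
    ⟨lt_of_le_of_lt (le_inf hx.1 hy.1) hu.1, lt_of_lt_of_le hu.2 (sup_le hx.2 hy.2)⟩
  exact ((hf.hasDerivWithinAt_du (Ioo_subset_Icc_self hu1) ht).hasDerivAt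
    (Icc_mem_nhds hu1.1 hu1.2)).hasDerivWithinAt

end Calculus

/-! ### Evolution and boundary values of the arclength derivatives of the curvature. -/

section Arclength

/-- The arclength derivative `v⁻¹ ∂f/∂u` on the strip. -/
noncomputable def Ds (a b : ℝ) (v f : ℝ × ℝ → ℝ) (p : ℝ × ℝ) : ℝ := (v p)⁻¹ * Du a b f p

/-- The `n`-th arclength derivative of `κ`. -/
noncomputable def curvDeriv (a b : ℝ) (v κ : ℝ × ℝ → ℝ) (n : ℕ) : ℝ × ℝ → ℝ :=
  (Ds a b v)^[n] κ

theorem curvDeriv_succ (a b : ℝ) (v κ : ℝ × ℝ → ℝ) (n : ℕ) :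
    curvDeriv a b v κ (n + 1) = Ds a b v (curvDeriv a b v κ n) :=
  Function.iterate_succ_apply' _ _ _

/-- The evolution equations of the speed `v` and the curvature `κ` under curve shortening with
fixed endpoints on a surface of constant curvature `G`. -/
structure CurvatureFlow (a b G : ℝ) (v κ : ℝ × ℝ → ℝ) : Prop where
  lt : a < b
  smooth_speed : SmoothOn a b v
  smooth_curv : SmoothOn a b κ
  speed_pos : ∀ p ∈ strip a b, 0 < v p
  dt_speed : ∀ p ∈ strip a b, Dt a b v p = -(κ p ^ 2 * v p)
  dt_curv : ∀ p ∈ strip a b, Dt a b κ p = Ds a b v (Ds a b v κ) p + G * κ p + κ p * κ p * κ p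
  left : ∀ t, 0 < t → κ (a, t) = 0
  right : ∀ t, 0 < t → κ (b, t) = 0

/-- Sums of cubic monomials of total order `n` in a sequence of functions. -/
inductive Cubic (k : ℕ → ℝ × ℝ → ℝ) : ℕ → (ℝ × ℝ → ℝ) → Prop
  | mono {n : ℕ} (i j l : ℕ) (h : i + j + l = n) : Cubic k n (fun p => k i p * k j p * k l p)
  | add {n : ℕ} {f g : ℝ × ℝ → ℝ} (hf : Cubic k n f) (hg : Cubic k n g) :
      Cubic k n (fun p => f p + g p)

namespace CurvatureFlow

variable {a b G : ℝ} {v κ f g : ℝ × ℝ → ℝ}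

theorem smooth_ds (h : CurvatureFlow a b G v κ) (hf : SmoothOn a b f) :
    SmoothOn a b (Ds a b v f) :=
  (ContDiffOn.inv h.smooth_speed fun p hp => (h.speed_pos p hp).ne').mul (hf.du h.lt)

theorem smooth_curvDeriv (h : CurvatureFlow a b G v κ) (n : ℕ) :
    SmoothOn a b (curvDeriv a b v κ n) := by
  induction n with
  | zero => exact h.smooth_curv
  | succ n ih => rw [curvDeriv_succ]; exact h.smooth_ds ih

theorem du_eq_mul_ds (h : CurvatureFlow a b G v κ) (f : ℝ × ℝ → ℝ) {p : ℝ × ℝ}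
    (hp : p ∈ strip a b) : Du a b f p = v p * Ds a b v f p := by
  unfold Ds; rw [mul_inv_cancel_left₀ (h.speed_pos p hp).ne']

theorem ds_congr (hfg : EqOn f g (strip a b)) {p : ℝ × ℝ} (hp : p ∈ strip a b) :
    Ds a b v f p = Ds a b v g p := by
  unfold Ds; rw [du_congr hfg hp]

theorem ds_add (h : CurvatureFlow a b G v κ) (hf : SmoothOn a b f) (hg : SmoothOn a b g)
    {p : ℝ × ℝ} (hp : p ∈ strip a b) :
    Ds a b v (fun q => f q + g q) p = Ds a b v f p + Ds a b v g p := by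
  obtain ⟨u, t⟩ := p
  obtain ⟨hu, ht⟩ := mem_strip.1 hp
  unfold Ds
  rw [SmoothOn.du_eq h.lt (ContDiffOn.add hf hg) hu ht
    ((hf.hasDerivWithinAt_du hu ht).add (hg.hasDerivWithinAt_du hu ht)), mul_add]

theorem ds_mul (h : CurvatureFlow a b G v κ) (hf : SmoothOn a b f) (hg : SmoothOn a b g)
    {p : ℝ × ℝ} (hp : p ∈ strip a b) :
    Ds a b v (fun q => f q * g q) p = Ds a b v f p * g p + f p * Ds a b v g p := by
  obtain ⟨u, t⟩ := p
  obtain ⟨hu, ht⟩ := mem_strip.1 hp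
  unfold Ds
  rw [SmoothOn.du_eq h.lt (ContDiffOn.mul hf hg) hu ht
    ((hf.hasDerivWithinAt_du hu ht).mul (hg.hasDerivWithinAt_du hu ht))]
  ring

theorem ds_const_mul (h : CurvatureFlow a b G v κ) (c : ℝ) (hf : SmoothOn a b f)
    {p : ℝ × ℝ} (hp : p ∈ strip a b) :
    Ds a b v (fun q => c * f q) p = c * Ds a b v f p := by
  obtain ⟨u, t⟩ := p
  obtain ⟨hu, ht⟩ := mem_strip.1 hp
  unfold Ds
  rw [SmoothOn.du_eq h.lt (ContDiffOn.mul contDiffOn_const hf) hu ht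
    ((hf.hasDerivWithinAt_du hu ht).const_mul c)]
  ring

/-- The commutator of the time and arclength derivatives. -/
theorem dt_ds (h : CurvatureFlow a b G v κ) (hf : SmoothOn a b f) {p : ℝ × ℝ}
    (hp : p ∈ strip a b) :
    Dt a b (Ds a b v f) p = Ds a b v (Dt a b f) p + κ p ^ 2 * Ds a b v f p := by
  obtain ⟨u, t⟩ := p
  obtain ⟨hu, ht⟩ := mem_strip.1 hp
  have hv := (h.speed_pos _ hp).ne'
  rw [(h.smooth_ds hf).dt_eq hu ht (((h.smooth_speed.hasDerivAt_dt hu ht).inv hv).mul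
    ((hf.du h.lt).hasDerivAt_dt hu ht)), h.dt_speed _ hp]
  unfold Ds
  rw [hf.du_dt h.lt hp]
  simp only [Pi.inv_apply]
  field_simp
  ring

theorem cubic_smooth (h : CurvatureFlow a b G v κ) {n : ℕ}
    (hf : Cubic (curvDeriv a b v κ) n f) : SmoothOn a b f := by
  induction hf with
  | mono i j l hn =>
    exact ((h.smooth_curvDeriv i).mul (h.smooth_curvDeriv j)).mul (h.smooth_curvDeriv l)
  | add _ _ hf hg => exact ContDiffOn.add hf hg

/-- Leibniz rule: the derivative falls on one factor at a time and raises the total order by one. -/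
theorem cubic_ds (h : CurvatureFlow a b G v κ) {n : ℕ}
    (hf : Cubic (curvDeriv a b v κ) n f) :
    ∃ g, Cubic (curvDeriv a b v κ) (n + 1) g ∧ EqOn (Ds a b v f) g (strip a b) := by
  induction hf with
  | mono i j l hn =>
    refine ⟨_, .add (.add (.mono (i + 1) j l (by omega)) (.mono i (j + 1) l (by omega)))
      (.mono i j (l + 1) (by omega)), fun p hp => ?_⟩
    have hi := h.smooth_curvDeriv i
    have hj := h.smooth_curvDeriv j
    rw [h.ds_mul (f := fun p => curvDeriv a b v κ i p * curvDeriv a b v κ j p)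
      (ContDiffOn.mul hi hj) (h.smooth_curvDeriv l) hp, h.ds_mul hi hj hp]
    simp only [curvDeriv_succ]
    ring
  | add hf hg ihf ihg =>
    obtain ⟨f', hf', ef⟩ := ihf
    obtain ⟨g', hg', eg⟩ := ihg
    refine ⟨_, .add hf' hg', fun p hp => ?_⟩
    rw [h.ds_add (h.cubic_smooth hf) (h.cubic_smooth hg) hp, ef hp, eg hp]

/-- The evolution equation of the arclength derivatives of the curvature. -/
theorem dt_curvDeriv (h : CurvatureFlow a b G v κ) (n : ℕ) :
    ∃ f, Cubic (curvDeriv a b v κ) n f ∧ ∀ p ∈ strip a b,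
      Dt a b (curvDeriv a b v κ n) p =
        curvDeriv a b v κ (n + 2) p + G * curvDeriv a b v κ n p + f p := by
  induction n with
  | zero => exact ⟨_, .mono 0 0 0 rfl, h.dt_curv⟩
  | succ n ih =>
    obtain ⟨f, hf, ef⟩ := ih
    obtain ⟨g, hg, eg⟩ := h.cubic_ds hf
    -- The new monomial `κ · κ · k (n+1)` is the commutator term of `dt_ds`.
    refine ⟨_, .add hg (.mono 0 0 (n + 1) (by omega)), fun p hp => ?_⟩
    have h0 := h.smooth_curvDeriv n
    have h2 := h.smooth_curvDeriv (n + 2)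
    rw [curvDeriv_succ a b v κ n, h.dt_ds h0 hp, ds_congr ef hp,
      h.ds_add (f := fun p => curvDeriv a b v κ (n + 2) p + G * curvDeriv a b v κ n p)
        (ContDiffOn.add h2 (ContDiffOn.mul contDiffOn_const h0)) (h.cubic_smooth hf) hp,
      h.ds_add (g := fun p => G * curvDeriv a b v κ n p) h2
        (ContDiffOn.mul contDiffOn_const h0) hp, h.ds_const_mul G h0 hp, eg hp,
      ← curvDeriv_succ, ← curvDeriv_succ]
    simp only [curvDeriv, Function.iterate_zero, id]
    ring

/-- Parity: three orders with an even sum cannot all be odd, so each monomial has a factor of even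
order. -/
theorem cubic_eq_zero {n : ℕ} (hf : Cubic (curvDeriv a b v κ) n f) (hn : Even n) {p : ℝ × ℝ}
    (hp : ∀ m ≤ n, Even m → curvDeriv a b v κ m p = 0) : f p = 0 := by
  induction hf with
  | mono i j l hijl =>
    subst hijl
    by_cases hi : Even i
    · simp [hp i (by omega) hi]
    · by_cases hj : Even j
      · simp [hp j (by omega) hj]
      · have hl : Even l := by
          rw [Nat.even_iff] at *; omega
        simp [hp l (by omega) hl]
  | add _ _ hf hg => simp [hf, hg]

/-- Where `k m` vanishes for all time, so does its time derivative; the evolution equation can then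
be solved for `k (m+2)`, all other terms being zero by induction and parity. -/
theorem curvDeriv_even_eq_zero (h : CurvatureFlow a b G v κ) {e : ℝ} (he : e ∈ Icc a b)
    (h0 : ∀ t, 0 < t → κ (e, t) = 0) (n : ℕ) :
    Even n → ∀ t, 0 < t → curvDeriv a b v κ n (e, t) = 0 := by
  induction n using Nat.strong_induction_on with
  | _ n ih =>
    intro hn t ht
    match n, ih, hn with
    | 0, _, _ => exact h0 t ht
    | 1, _, hn => exact absurd hn (by decide)
    | m + 2, ih, hn =>
      have hm : Even m := by rw [Nat.even_iff] at *; omega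
      obtain ⟨f, hf, ef⟩ := h.dt_curvDeriv m
      have hp := mem_strip.2 ⟨he, ht⟩
      have h1 : Dt a b (curvDeriv a b v κ m) (e, t) = 0 := by
        refine (h.smooth_curvDeriv m).dt_eq he ht
          ((hasDerivAt_const t (0 : ℝ)).congr_of_eventuallyEq ?_)
        filter_upwards [Ioi_mem_nhds ht] with τ hτ
        exact ih m (by omega) hm τ hτ
      have h2 : f (e, t) = 0 := cubic_eq_zero hf hm fun k hk hk' => ih k (by omega) hk' t ht
      have h3 := ef _ hp
      rw [h1, h2, ih m (by omega) hm t ht] at h3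
      linarith

theorem curvDeriv_ends (h : CurvatureFlow a b G v κ) {n : ℕ} (hn : Even n) {t : ℝ}
    (ht : 0 < t) : curvDeriv a b v κ n (a, t) = 0 ∧ curvDeriv a b v κ n (b, t) = 0 :=
  ⟨h.curvDeriv_even_eq_zero (left_mem_Icc.2 h.lt.le) h.left n hn t ht,
    h.curvDeriv_even_eq_zero (right_mem_Icc.2 h.lt.le) h.right n hn t ht⟩

/-- Even orders vanish at the ends; an odd order is the derivative of an even one, so Rolle applies.
The zero is the base point for all sup bounds. -/
theorem exists_curvDeriv_eq_zero (h : CurvatureFlow a b G v κ) (n : ℕ) {t : ℝ} (ht : 0 < t) :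
    ∃ u ∈ Icc a b, curvDeriv a b v κ n (u, t) = 0 := by
  rcases Nat.even_or_odd n with hn | ⟨m, rfl⟩
  · exact ⟨a, left_mem_Icc.2 h.lt.le, (h.curvDeriv_ends hn ht).1⟩
  · have he := h.curvDeriv_ends (even_two_mul m) ht
    have hs := h.smooth_curvDeriv (2 * m)
    obtain ⟨u, hu, hu0⟩ := exists_hasDerivAt_eq_zero h.lt (hs.continuousOn_slice ht)
      (he.1.trans he.2.symm) (fun u hu => (hs.hasDerivWithinAt_du (Ioo_subset_Icc_self hu)
        ht).hasDerivAt (Icc_mem_nhds hu.1 hu.2))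
    refine ⟨u, Ioo_subset_Icc_self hu, ?_⟩
    rw [curvDeriv_succ, Ds, hu0, mul_zero]

end CurvatureFlow

end Arclength

/-! ### Interpolation inequalities and the differential inequality for the energies. -/

section Energy

/-- Weighted Cauchy-Schwarz: the integral of `(f + x g)² w` is a nonnegative quadratic in `x`, so
its discriminant is nonpositive. -/
theorem sq_integral_mul_le {a b : ℝ} (hab : a ≤ b) {f g w : ℝ → ℝ}
    (hf : ContinuousOn f (Icc a b)) (hg : ContinuousOn g (Icc a b))
    (hw : ContinuousOn w (Icc a b)) (hw0 : ∀ u ∈ Icc a b, 0 ≤ w u) :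
    (∫ u in a..b, f u * g u * w u) ^ 2 ≤
      (∫ u in a..b, f u ^ 2 * w u) * ∫ u in a..b, g u ^ 2 * w u := by
  have hint : ∀ {φ : ℝ → ℝ}, ContinuousOn φ (Icc a b) →
      IntervalIntegrable φ MeasureTheory.volume a b := fun h =>
    ContinuousOn.intervalIntegrable (by rwa [uIcc_of_le hab])
  have i1 := hint (φ := fun u => f u ^ 2 * w u) ((hf.pow 2).mul hw)
  have i2 := hint (φ := fun u => f u * g u * w u) ((hf.mul hg).mul hw)
  have i3 := hint (φ := fun u => g u ^ 2 * w u) ((hg.pow 2).mul hw)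
  have key : ∀ x : ℝ, 0 ≤ (∫ u in a..b, g u ^ 2 * w u) * (x * x) +
      (2 * ∫ u in a..b, f u * g u * w u) * x + ∫ u in a..b, f u ^ 2 * w u := by
    intro x
    have h0 : 0 ≤ ∫ u in a..b, (f u + x * g u) ^ 2 * w u :=
      intervalIntegral.integral_nonneg hab fun u hu => mul_nonneg (sq_nonneg _) (hw0 u hu)
    have h1 : ∫ u in a..b, (f u + x * g u) ^ 2 * w u =
        ∫ u in a..b, (f u ^ 2 * w u + 2 * x * (f u * g u * w u) + x ^ 2 * (g u ^ 2 * w u)) :=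
      intervalIntegral.integral_congr fun u _ => by ring
    rw [h1, intervalIntegral.integral_add (i1.add (i2.const_mul _)) (i3.const_mul _),
      intervalIntegral.integral_add i1 (i2.const_mul _), intervalIntegral.integral_const_mul,
      intervalIntegral.integral_const_mul] at h0
    linarith
  have := discrim_le_zero key
  rw [discrim] at this
  nlinarith

theorem antitoneOn_Ici_of_hasDerivAt {f f' : ℝ → ℝ} {T : ℝ}
    (hf : ∀ t, T ≤ t → HasDerivAt f (f' t) t) (hf' : ∀ t, T ≤ t → f' t ≤ 0) :
    AntitoneOn f (Ici T) := by
  refine antitoneOn_of_deriv_nonpos (convex_Ici T)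
    (fun t ht => (hf t ht).continuousAt.continuousWithinAt)
    (fun t ht => (hf t (interior_subset ht)).differentiableAt.differentiableWithinAt)
    fun t ht => ?_
  rw [(hf t (interior_subset ht)).deriv]
  exact hf' t (interior_subset ht)

/-- The length of the curve at time `t`. -/
noncomputable def length (a b : ℝ) (v : ℝ × ℝ → ℝ) (t : ℝ) : ℝ := ∫ u in a..b, v (u, t)

/-- The squared `L²` norm of the `n`-th arclength derivative of the curvature at time `t`. -/
noncomputable def energy (a b : ℝ) (v κ : ℝ × ℝ → ℝ) (n : ℕ) (t : ℝ) : ℝ :=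
  ∫ u in a..b, curvDeriv a b v κ n (u, t) ^ 2 * v (u, t)

theorem SmoothOn.abs_le_integral_abs_du {a b : ℝ} {f : ℝ × ℝ → ℝ} (hab : a < b)
    (hf : SmoothOn a b f) {t x y : ℝ} (ht : 0 < t) (hx : x ∈ Icc a b) (hy : y ∈ Icc a b)
    (h0 : f (x, t) = 0) : |f (y, t)| ≤ ∫ u in a..b, |Du a b f (u, t)| := by
  have h1 := hf.integral_du hab ht hx hy
  rw [h0, sub_zero] at h1
  have hnn : 0 ≤ ∫ u in a..b, |Du a b f (u, t)| :=
    intervalIntegral.integral_nonneg hab.le fun _ _ => abs_nonneg _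
  rw [← h1, ← abs_of_nonneg hnn]
  refine (intervalIntegral.norm_integral_le_abs_integral_norm (μ := MeasureTheory.volume)
    (f := fun u => Du a b f (u, t)) (a := x) (b := y)).trans ?_
  simp only [Real.norm_eq_abs]
  refine intervalIntegral.abs_integral_mono_interval ?_
    (Eventually.of_forall fun _ => abs_nonneg _) ((hf.du hab).intervalIntegrable hab ht).abs
  rw [uIoc_of_le hab.le]
  exact Ioc_subset_Ioc (le_inf hx.1 hy.1) (sup_le hx.2 hy.2)

namespace CurvatureFlow

variable {a b G : ℝ} {v κ f g : ℝ × ℝ → ℝ}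

theorem length_nonneg (h : CurvatureFlow a b G v κ) {t : ℝ} (ht : 0 < t) :
    0 ≤ length a b v t :=
  intervalIntegral.integral_nonneg h.lt.le fun _ hu => (h.speed_pos _ (mem_strip.2 ⟨hu, ht⟩)).le

theorem energy_nonneg (h : CurvatureFlow a b G v κ) (n : ℕ) {t : ℝ} (ht : 0 < t) :
    0 ≤ energy a b v κ n t :=
  intervalIntegral.integral_nonneg h.lt.le fun _ hu =>
    mul_nonneg (sq_nonneg _) (h.speed_pos _ (mem_strip.2 ⟨hu, ht⟩)).le

theorem hasDerivAt_length (h : CurvatureFlow a b G v κ) {t : ℝ} (ht : 0 < t) :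
    HasDerivAt (length a b v) (-energy a b v κ 0 t) t := by
  have h1 := h.smooth_speed.hasDerivAt_integral h.lt ht
  have h2 : ∫ u in a..b, Dt a b v (u, t) = -energy a b v κ 0 t := by
    unfold energy
    rw [← intervalIntegral.integral_neg]
    refine intervalIntegral.integral_congr fun u hu => ?_
    rw [uIcc_of_le h.lt.le] at hu
    exact h.dt_speed _ (mem_strip.2 ⟨hu, ht⟩)
  rwa [h2] at h1

theorem length_le (h : CurvatureFlow a b G v κ) {t : ℝ} (ht : 1 ≤ t) :
    length a b v t ≤ length a b v 1 := by
  have hpos : ∀ τ : ℝ, 1 ≤ τ → 0 < τ := fun τ hτ => lt_of_lt_of_le one_pos hτ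
  exact antitoneOn_Ici_of_hasDerivAt (fun τ hτ => h.hasDerivAt_length (hpos τ hτ))
    (fun τ hτ => neg_nonpos.2 (h.energy_nonneg 0 (hpos τ hτ))) self_mem_Ici ht ht

theorem sq_integral_abs_mul_le (h : CurvatureFlow a b G v κ) (hf : SmoothOn a b f)
    (hg : SmoothOn a b g) {t : ℝ} (ht : 0 < t) :
    (∫ u in a..b, |f (u, t) * g (u, t) * v (u, t)|) ^ 2 ≤
      (∫ u in a..b, f (u, t) ^ 2 * v (u, t)) * ∫ u in a..b, g (u, t) ^ 2 * v (u, t) := by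
  have h1 := sq_integral_mul_le h.lt.le (hf.continuousOn_slice ht).abs
    (hg.continuousOn_slice ht).abs (h.smooth_speed.continuousOn_slice ht)
    fun u hu => (h.speed_pos _ (mem_strip.2 ⟨hu, ht⟩)).le
  simp only [sq_abs] at h1
  convert h1 using 2
  refine intervalIntegral.integral_congr fun u hu => ?_
  rw [uIcc_of_le h.lt.le] at hu
  simp only [abs_mul, abs_of_pos (h.speed_pos _ (mem_strip.2 ⟨hu, ht⟩))]

/-- Integrate `k (n+1)` in arclength from a zero of `k n`, and apply Cauchy-Schwarz against the
constant `1`, whose squared norm is the length. -/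
theorem sq_curvDeriv_le (h : CurvatureFlow a b G v κ) (n : ℕ) {u t : ℝ} (hu : u ∈ Icc a b)
    (ht : 0 < t) :
    curvDeriv a b v κ n (u, t) ^ 2 ≤ length a b v t * energy a b v κ (n + 1) t := by
  obtain ⟨x, hx, hx0⟩ := h.exists_curvDeriv_eq_zero n ht
  have h1 := (h.smooth_curvDeriv n).abs_le_integral_abs_du h.lt ht hx hu hx0
  have h2 := h.sq_integral_abs_mul_le (f := fun _ => 1) contDiffOn_const
    (h.smooth_curvDeriv (n + 1)) ht
  have h3 : ∫ u in a..b, |Du a b (curvDeriv a b v κ n) (u, t)| =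
      ∫ u in a..b, |1 * curvDeriv a b v κ (n + 1) (u, t) * v (u, t)| := by
    refine intervalIntegral.integral_congr fun u hu => ?_
    rw [uIcc_of_le h.lt.le] at hu
    rw [h.du_eq_mul_ds _ (mem_strip.2 ⟨hu, ht⟩), curvDeriv_succ, one_mul, mul_comm]
  rw [h3] at h1
  simp only [one_pow, one_mul] at h1 h2
  rw [← sq_abs]
  exact (pow_le_pow_left₀ (abs_nonneg _) h1 2).trans h2

/-- Integrate `(κ²)ₛ = 2 κ κₛ` from the end `a`, then apply Cauchy-Schwarz. Unlike
`sq_curvDeriv_le`, this involves only the square root of the higher energy, which is what lets the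
term `κ³` be absorbed when `n = 0`. -/
theorem curv_pow_four_le (h : CurvatureFlow a b G v κ) {u t : ℝ} (hu : u ∈ Icc a b)
    (ht : 0 < t) :
    (κ (u, t) ^ 2) ^ 2 ≤ 4 * (energy a b v κ 0 t * energy a b v κ 1 t) := by
  have h0 : κ (a, t) * κ (a, t) = 0 := by rw [h.left t ht, zero_mul]
  have hs : SmoothOn a b (fun p => κ p * κ p) := ContDiffOn.mul h.smooth_curv h.smooth_curv
  have h1 := hs.abs_le_integral_abs_du h.lt ht (left_mem_Icc.2 h.lt.le) hu h0
  have h2 := h.sq_integral_abs_mul_le (h.smooth_curvDeriv 0) (h.smooth_curvDeriv 1) ht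
  have h3 : ∫ u in a..b, |Du a b (fun p => κ p * κ p) (u, t)| =
      2 * ∫ u in a..b, |curvDeriv a b v κ 0 (u, t) * curvDeriv a b v κ 1 (u, t) * v (u, t)| := by
    rw [← intervalIntegral.integral_const_mul]
    refine intervalIntegral.integral_congr fun u hu => ?_
    rw [uIcc_of_le h.lt.le] at hu
    have hp := mem_strip.2 ⟨hu, ht⟩
    rw [h.du_eq_mul_ds _ hp, h.ds_mul h.smooth_curv h.smooth_curv hp, curvDeriv_succ]
    simp only [curvDeriv, Function.iterate_zero, id]
    rw [← abs_two, ← abs_mul]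
    congr 1
    ring
  rw [h3] at h1
  have h4 := pow_le_pow_left₀ (abs_nonneg _) h1 2
  rw [sq_abs] at h4
  change _ ≤ energy a b v κ 0 t * energy a b v κ 1 t at h2
  nlinarith

/-- Poincaré inequality, by integrating the sup bound. Time `1` serves as reference because
smoothness, and with it control of the length, is available only for positive times. -/
theorem energy_le_succ (h : CurvatureFlow a b G v κ) (n : ℕ) {t : ℝ} (ht : 1 ≤ t) :
    energy a b v κ n t ≤ length a b v 1 ^ 2 * energy a b v κ (n + 1) t := by
  have ht0 : 0 < t := by linarith
  have hE := h.energy_nonneg (n + 1) ht0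
  have h1 : energy a b v κ n t ≤
      ∫ u in a..b, length a b v t * energy a b v κ (n + 1) t * v (u, t) := by
    refine intervalIntegral.integral_mono_on h.lt.le
      (SmoothOn.intervalIntegrable (f := fun p => curvDeriv a b v κ n p ^ 2 * v p)
        (((h.smooth_curvDeriv n).pow 2).mul h.smooth_speed) h.lt ht0)
      ((h.smooth_speed.intervalIntegrable h.lt ht0).const_mul _) fun u hu => ?_
    exact mul_le_mul_of_nonneg_right (h.sq_curvDeriv_le n hu ht0)
      (h.speed_pos _ (mem_strip.2 ⟨hu, ht0⟩)).le
  rw [intervalIntegral.integral_const_mul] at h1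
  change _ ≤ _ * length a b v t at h1
  calc _ ≤ _ := h1
    _ = length a b v t ^ 2 * energy a b v κ (n + 1) t := by ring
    _ ≤ _ := mul_le_mul_of_nonneg_right
      (pow_le_pow_left₀ (h.length_nonneg ht0) (h.length_le ht) 2) hE

theorem energy_le_of_le (h : CurvatureFlow a b G v κ) {m n : ℕ} (hmn : m ≤ n) :
    ∃ C, 0 ≤ C ∧ ∀ t, 1 ≤ t → energy a b v κ m t ≤ C * energy a b v κ n t := by
  induction n, hmn using Nat.le_induction with
  | base => exact ⟨1, zero_le_one, fun t _ => by rw [one_mul]⟩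
  | succ n _ ih =>
    obtain ⟨C, hC, hm⟩ := ih
    refine ⟨C * length a b v 1 ^ 2, by positivity, fun t ht => (hm t ht).trans ?_⟩
    rw [mul_assoc]
    exact mul_le_mul_of_nonneg_left (h.energy_le_succ n ht) hC

theorem sq_curvDeriv_le_energy (h : CurvatureFlow a b G v κ) {m n : ℕ} (hmn : m < n) :
    ∃ C, 0 ≤ C ∧ ∀ t, 1 ≤ t → ∀ u ∈ Icc a b,
      curvDeriv a b v κ m (u, t) ^ 2 ≤ C * energy a b v κ n t := by
  obtain ⟨C, hC, hm⟩ := h.energy_le_of_le (Nat.succ_le_of_lt hmn)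
  have hL := h.length_nonneg one_pos
  refine ⟨length a b v 1 * C, by positivity, fun t ht u hu => ?_⟩
  have ht0 : 0 < t := by linarith
  calc _ ≤ _ := h.sq_curvDeriv_le m hu ht0
    _ ≤ length a b v 1 * energy a b v κ (m + 1) t :=
      mul_le_mul_of_nonneg_right (h.length_le ht) (h.energy_nonneg _ ht0)
    _ ≤ _ := by rw [mul_assoc]; exact mul_le_mul_of_nonneg_left (hm t ht) hL

/-- A quartic term in which two factors have order less than `n` is controlled by the energy. -/
theorem integral_quartic_le (h : CurvatureFlow a b G v κ) {n i j l : ℕ} (hi : i ≤ n) (hj : j < n)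
    (hl : l < n) :
    ∃ C, 0 ≤ C ∧ ∀ t, 1 ≤ t → ∫ u in a..b, curvDeriv a b v κ n (u, t) *
      (curvDeriv a b v κ i (u, t) * curvDeriv a b v κ j (u, t) * curvDeriv a b v κ l (u, t)) *
        v (u, t) ≤ C * energy a b v κ n t ^ 2 := by
  obtain ⟨Ci, hCi, hi⟩ := h.energy_le_of_le hi
  obtain ⟨Cj, hCj, hj⟩ := h.sq_curvDeriv_le_energy hj
  obtain ⟨Cl, hCl, hl⟩ := h.sq_curvDeriv_le_energy hl
  -- The factor `1/4` comes from using `2|xy| ≤ x² + y²` on each of two pairs; `1 + Ci` bounds the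
  -- sum of the energies of orders `n` and `i`.
  refine ⟨(Cj + Cl) / 4 * (1 + Ci), by positivity, fun t ht => ?_⟩
  have ht0 : 0 < t := by linarith
  have hn := h.smooth_curvDeriv n
  have si := h.smooth_curvDeriv i
  have hEn := h.energy_nonneg n ht0
  set En := energy a b v κ n t with hEn'
  have in1 := SmoothOn.intervalIntegrable (f := fun p => curvDeriv a b v κ n p ^ 2 * v p)
    ((hn.pow 2).mul h.smooth_speed) h.lt ht0
  have in2 := SmoothOn.intervalIntegrable (f := fun p => curvDeriv a b v κ i p ^ 2 * v p)
    ((si.pow 2).mul h.smooth_speed) h.lt ht0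
  have h1 : ∫ u in a..b, curvDeriv a b v κ n (u, t) *
      (curvDeriv a b v κ i (u, t) * curvDeriv a b v κ j (u, t) * curvDeriv a b v κ l (u, t)) *
        v (u, t) ≤ ∫ u in a..b, (Cj + Cl) / 4 * En * (curvDeriv a b v κ n (u, t) ^ 2 * v (u, t) +
          curvDeriv a b v κ i (u, t) ^ 2 * v (u, t)) := by
    refine intervalIntegral.integral_mono_on h.lt.le
      (SmoothOn.intervalIntegrable (f := fun p => curvDeriv a b v κ n p *
        (curvDeriv a b v κ i p * curvDeriv a b v κ j p * curvDeriv a b v κ l p) * v p)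
        ((hn.mul ((si.mul (h.smooth_curvDeriv j)).mul (h.smooth_curvDeriv l))).mul
          h.smooth_speed) h.lt ht0)
      ((in1.add in2).const_mul _) fun u hu => ?_
    have hv := (h.speed_pos _ (mem_strip.2 ⟨hu, ht0⟩)).le
    rw [← add_mul, ← mul_assoc (_ * En)]
    refine mul_le_mul_of_nonneg_right ?_ hv
    set x := curvDeriv a b v κ n (u, t)
    set y := curvDeriv a b v κ i (u, t)
    have hzw := add_le_add (hj t ht u hu) (hl t ht u hu)
    set z := curvDeriv a b v κ j (u, t)
    set w := curvDeriv a b v κ l (u, t)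
    calc x * (y * z * w) = (x * y) * (z * w) := by ring
      _ ≤ |x * y| * |z * w| := by rw [← abs_mul]; exact le_abs_self _
      _ ≤ ((x ^ 2 + y ^ 2) / 2) * ((z ^ 2 + w ^ 2) / 2) := by
        refine mul_le_mul ?_ ?_ (abs_nonneg _) (by positivity)
        · rw [abs_le]; constructor <;> nlinarith [sq_nonneg (x + y), sq_nonneg (x - y)]
        · rw [abs_le]; constructor <;> nlinarith [sq_nonneg (z + w), sq_nonneg (z - w)]
      _ ≤ ((x ^ 2 + y ^ 2) / 2) * ((Cj * En + Cl * En) / 2) :=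
        mul_le_mul_of_nonneg_left (by linarith) (by positivity)
      _ = _ := by ring
  rw [intervalIntegral.integral_const_mul, intervalIntegral.integral_add in1 in2] at h1
  change _ ≤ (Cj + Cl) / 4 * En * (En + energy a b v κ i t) at h1
  calc _ ≤ _ := h1
    _ ≤ (Cj + Cl) / 4 * En * (En + Ci * En) :=
      mul_le_mul_of_nonneg_left (by linarith [hi t ht]) (by positivity)
    _ = _ := by ring

/-- Bound one factor `κ²` by its supremum `2 √(E 0 · E 1)`; what results is `2 √(E 1 · (E 0)³)`,
which Young's inequality splits. -/
theorem integral_curv_pow_four_le (h : CurvatureFlow a b G v κ) {ε : ℝ} (hε : 0 < ε) {t : ℝ}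
    (ht : 0 < t) : ∫ u in a..b, κ (u, t) * (κ (u, t) * κ (u, t) * κ (u, t)) * v (u, t) ≤
      ε * energy a b v κ 1 t + ε⁻¹ * energy a b v κ 0 t ^ 3 := by
  have h0 := h.energy_nonneg 0 ht
  have h1 := h.energy_nonneg 1 ht
  set s := Real.sqrt (4 * (energy a b v κ 0 t * energy a b v κ 1 t)) with hs
  have hs2 : s ^ 2 = 4 * (energy a b v κ 0 t * energy a b v κ 1 t) :=
    Real.sq_sqrt (by positivity)
  have h2 : ∫ u in a..b, κ (u, t) * (κ (u, t) * κ (u, t) * κ (u, t)) * v (u, t) ≤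
      ∫ u in a..b, s * (curvDeriv a b v κ 0 (u, t) ^ 2 * v (u, t)) := by
    have hk := h.smooth_curv
    refine intervalIntegral.integral_mono_on h.lt.le
      (SmoothOn.intervalIntegrable (f := fun p => κ p * (κ p * κ p * κ p) * v p)
        ((hk.mul ((hk.mul hk).mul hk)).mul h.smooth_speed) h.lt ht)
      ((SmoothOn.intervalIntegrable (f := fun p => curvDeriv a b v κ 0 p ^ 2 * v p)
        (((h.smooth_curvDeriv 0).pow 2).mul h.smooth_speed) h.lt ht).const_mul _) fun u hu => ?_
    have hv := (h.speed_pos _ (mem_strip.2 ⟨hu, ht⟩)).le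
    have h3 : κ (u, t) ^ 2 ≤ s := Real.le_sqrt_of_sq_le (h.curv_pow_four_le hu ht)
    rw [← mul_assoc s]
    refine mul_le_mul_of_nonneg_right ?_ hv
    change _ ≤ s * κ (u, t) ^ 2
    calc _ = κ (u, t) ^ 2 * κ (u, t) ^ 2 := by ring
      _ ≤ _ := mul_le_mul_of_nonneg_right h3 (sq_nonneg _)
  rw [intervalIntegral.integral_const_mul] at h2
  change _ ≤ s * energy a b v κ 0 t at h2
  refine h2.trans (abs_le_of_sq_le_sq' ?_ (by positivity)).2
  have : (ε * energy a b v κ 1 t + ε⁻¹ * energy a b v κ 0 t ^ 3) ^ 2 -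
      (s * energy a b v κ 0 t) ^ 2 =
      (ε * energy a b v κ 1 t - ε⁻¹ * energy a b v κ 0 t ^ 3) ^ 2 := by
    rw [mul_pow, hs2]; field_simp; ring
  nlinarith [sq_nonneg (ε * energy a b v κ 1 t - ε⁻¹ * energy a b v κ 0 t ^ 3)]

/-- For `n > 0` at most one factor of a monomial has order `n`. After permuting it to the front, the
other two are bounded by `E n`, giving `C (E n)²`. Only `n = 0` uses the `ε` term. -/
theorem integral_cubic_le (h : CurvatureFlow a b G v κ) {n : ℕ}
    (hf : Cubic (curvDeriv a b v κ) n f) {ε : ℝ} (hε : 0 < ε) :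
    ∃ C, 0 ≤ C ∧ ∀ t, 1 ≤ t → ∫ u in a..b, curvDeriv a b v κ n (u, t) * f (u, t) * v (u, t) ≤
      ε * energy a b v κ (n + 1) t + C * (energy a b v κ n t + energy a b v κ n t ^ 3) := by
  induction hf generalizing ε with
  | mono i j l hn =>
    rcases Nat.eq_zero_or_pos n with rfl | hpos
    · obtain ⟨⟨rfl, rfl⟩, rfl⟩ : (i = 0 ∧ j = 0) ∧ l = 0 := by omega
      refine ⟨ε⁻¹, by positivity, fun t ht => ?_⟩
      have ht0 : 0 < t := by linarith
      have h1 := h.integral_curv_pow_four_le hε ht0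
      have h2 : 0 ≤ ε⁻¹ * energy a b v κ 0 t :=
        mul_nonneg (by positivity) (h.energy_nonneg 0 ht0)
      simp only [zero_add, mul_add]
      exact h1.trans (by linarith)
    · have key : ∃ C, 0 ≤ C ∧ ∀ t, 1 ≤ t → ∫ u in a..b, curvDeriv a b v κ n (u, t) *
          (curvDeriv a b v κ i (u, t) * curvDeriv a b v κ j (u, t) *
            curvDeriv a b v κ l (u, t)) * v (u, t) ≤ C * energy a b v κ n t ^ 2 := by
        by_cases hj : j < n
        · by_cases hl : l < n
          · exact h.integral_quartic_le (by omega) hj hl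
          · obtain ⟨C, hC, H⟩ := h.integral_quartic_le (n := n) (i := l) (j := i) (l := j)
              (by omega) (by omega) hj
            refine ⟨C, hC, fun t ht => le_trans (le_of_eq ?_) (H t ht)⟩
            exact intervalIntegral.integral_congr fun u _ => by ring
        · obtain ⟨C, hC, H⟩ := h.integral_quartic_le (n := n) (i := j) (j := i) (l := l)
            (by omega) (by omega) (by omega)
          refine ⟨C, hC, fun t ht => le_trans (le_of_eq ?_) (H t ht)⟩
          exact intervalIntegral.integral_congr fun u _ => by ring
      obtain ⟨C, hC, H⟩ := key
      refine ⟨C, hC, fun t ht => (H t ht).trans ?_⟩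
      have ht0 : 0 < t := by linarith
      have h1 := mul_nonneg hε.le (h.energy_nonneg (n + 1) ht0)
      have h2 := h.energy_nonneg n ht0
      set x := energy a b v κ n t
      have h3 : x ^ 2 ≤ x + x ^ 3 := by nlinarith [mul_nonneg h2 (sq_nonneg (x - 1))]
      nlinarith [mul_le_mul_of_nonneg_left h3 hC]
  | @add f g hf hg ihf ihg =>
    obtain ⟨C, hC, H⟩ := ihf (half_pos hε)
    obtain ⟨D, hD, K⟩ := ihg (half_pos hε)
    refine ⟨C + D, by positivity, fun t ht => ?_⟩
    have ht0 : 0 < t := by linarith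
    have hn := h.smooth_curvDeriv n
    have h1 : ∫ u in a..b, curvDeriv a b v κ n (u, t) * (f (u, t) + g (u, t)) * v (u, t) =
        (∫ u in a..b, curvDeriv a b v κ n (u, t) * f (u, t) * v (u, t)) +
          ∫ u in a..b, curvDeriv a b v κ n (u, t) * g (u, t) * v (u, t) := by
      rw [← intervalIntegral.integral_add
        (SmoothOn.intervalIntegrable (f := fun p => curvDeriv a b v κ n p * f p * v p)
          ((hn.mul (h.cubic_smooth hf)).mul h.smooth_speed) h.lt ht0)
        (SmoothOn.intervalIntegrable (f := fun p => curvDeriv a b v κ n p * g p * v p)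
          ((hn.mul (h.cubic_smooth hg)).mul h.smooth_speed) h.lt ht0)]
      exact intervalIntegral.integral_congr fun u _ => by ring
    simp only [h1]
    linarith [H t ht, K t ht]

/-- Integration by parts. The boundary term is `k n · k (n+1)`, and one of the two orders is even.
-/
theorem integral_mul_curvDeriv (h : CurvatureFlow a b G v κ) (n : ℕ) {t : ℝ} (ht : 0 < t) :
    ∫ u in a..b, curvDeriv a b v κ n (u, t) * curvDeriv a b v κ (n + 2) (u, t) * v (u, t) =
      -energy a b v κ (n + 1) t := by
  have h0 := h.smooth_curvDeriv n
  have h1 := h.smooth_curvDeriv (n + 1)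
  have h2 := h.smooth_curvDeriv (n + 2)
  have hs : SmoothOn a b (fun p => curvDeriv a b v κ n p * curvDeriv a b v κ (n + 1) p) :=
    ContDiffOn.mul h0 h1
  have hft := hs.integral_du h.lt ht (left_mem_Icc.2 h.lt.le) (right_mem_Icc.2 h.lt.le)
  have hends : curvDeriv a b v κ n (b, t) * curvDeriv a b v κ (n + 1) (b, t) -
      curvDeriv a b v κ n (a, t) * curvDeriv a b v κ (n + 1) (a, t) = 0 := by
    rcases Nat.even_or_odd n with hn | hn
    · simp [h.curvDeriv_ends hn ht]
    · simp [h.curvDeriv_ends hn.add_one ht]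
  have hsum : ∫ u in a..b, Du a b (fun p => curvDeriv a b v κ n p * curvDeriv a b v κ (n + 1) p)
      (u, t) = energy a b v κ (n + 1) t +
        ∫ u in a..b, curvDeriv a b v κ n (u, t) * curvDeriv a b v κ (n + 2) (u, t) * v (u, t) := by
    unfold energy
    rw [← intervalIntegral.integral_add
      (SmoothOn.intervalIntegrable (f := fun p => curvDeriv a b v κ (n + 1) p ^ 2 * v p)
        ((h1.pow 2).mul h.smooth_speed) h.lt ht)
      (SmoothOn.intervalIntegrable
        (f := fun p => curvDeriv a b v κ n p * curvDeriv a b v κ (n + 2) p * v p)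
        ((h0.mul h2).mul h.smooth_speed) h.lt ht)]
    refine intervalIntegral.integral_congr fun u hu => ?_
    rw [uIcc_of_le h.lt.le] at hu
    have hp := mem_strip.2 ⟨hu, ht⟩
    rw [h.du_eq_mul_ds _ hp, h.ds_mul h0 h1 hp, curvDeriv_succ _ _ _ _ (n + 1),
      curvDeriv_succ _ _ _ _ n]
    ring
  rw [hsum, hends] at hft
  linarith

theorem hasDerivAt_energy (h : CurvatureFlow a b G v κ) (n : ℕ) :
    ∃ f, Cubic (curvDeriv a b v κ) n f ∧ ∀ t, 0 < t →
      HasDerivAt (energy a b v κ n) (-2 * energy a b v κ (n + 1) t + 2 * G * energy a b v κ n t +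
        2 * (∫ u in a..b, curvDeriv a b v κ n (u, t) * f (u, t) * v (u, t)) -
        ∫ u in a..b, (κ (u, t) * curvDeriv a b v κ n (u, t)) ^ 2 * v (u, t)) t := by
  obtain ⟨f, hf, ef⟩ := h.dt_curvDeriv n
  refine ⟨f, hf, fun t ht => ?_⟩
  have h0 := h.smooth_curvDeriv n
  have h2 := h.smooth_curvDeriv (n + 2)
  have hs : SmoothOn a b (fun p => curvDeriv a b v κ n p ^ 2 * v p) :=
    ContDiffOn.mul (ContDiffOn.pow h0 2) h.smooth_speed
  have hd := hs.hasDerivAt_integral h.lt ht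
  refine hd.congr_deriv (Eq.symm ?_)
  have i0 := SmoothOn.intervalIntegrable (f := fun p => curvDeriv a b v κ n p ^ 2 * v p)
    hs h.lt ht
  have i1 := SmoothOn.intervalIntegrable
    (f := fun p => curvDeriv a b v κ n p * curvDeriv a b v κ (n + 2) p * v p)
    ((h0.mul h2).mul h.smooth_speed) h.lt ht
  have i2 := SmoothOn.intervalIntegrable (f := fun p => curvDeriv a b v κ n p * f p * v p)
    ((h0.mul (h.cubic_smooth hf)).mul h.smooth_speed) h.lt ht
  have i3 := SmoothOn.intervalIntegrable (f := fun p => (κ p * curvDeriv a b v κ n p) ^ 2 * v p)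
    (((h.smooth_curv.mul h0).pow 2).mul h.smooth_speed) h.lt ht
  have h3 : -2 * energy a b v κ (n + 1) t =
      2 * ∫ u in a..b, curvDeriv a b v κ n (u, t) * curvDeriv a b v κ (n + 2) (u, t) * v (u, t) := by
    rw [h.integral_mul_curvDeriv n ht]; ring
  rw [h3, energy, ← intervalIntegral.integral_const_mul, ← intervalIntegral.integral_const_mul,
    ← intervalIntegral.integral_const_mul, ← intervalIntegral.integral_add (i1.const_mul _)
    (i0.const_mul _), ← intervalIntegral.integral_add ((i1.const_mul _).add (i0.const_mul _))
    (i2.const_mul _), ← intervalIntegral.integral_sub (((i1.const_mul _).add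
    (i0.const_mul _)).add (i2.const_mul _)) i3]
  refine intervalIntegral.integral_congr fun u hu => ?_
  rw [uIcc_of_le h.lt.le] at hu
  have hp := mem_strip.2 ⟨hu, ht⟩
  have hdt := hs.dt_eq hu ht (((h0.hasDerivAt_dt hu ht).pow 2).mul
    (h.smooth_speed.hasDerivAt_dt hu ht))
  rw [hdt, ef _ hp, h.dt_speed _ hp]
  simp only [Pi.pow_apply]
  ring

theorem exists_deriv_energy_le (h : CurvatureFlow a b G v κ) (n : ℕ) :
    ∃ C, 0 ≤ C ∧ ∃ E' : ℝ → ℝ, ∀ t, 1 ≤ t → HasDerivAt (energy a b v κ n) (E' t) t ∧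
      E' t ≤ -energy a b v κ (n + 1) t + C * (energy a b v κ n t + energy a b v κ n t ^ 3) := by
  obtain ⟨f, hf, hd⟩ := h.hasDerivAt_energy n
  -- With `ε = 1/2` the cubic term costs one copy of `E (n+1)`, leaving one of the two available;
  -- the term from the shrinking arclength element has a favourable sign and is dropped.
  obtain ⟨C, hC, hc⟩ := h.integral_cubic_le hf (ε := 1 / 2) (by norm_num)
  refine ⟨2 * |G| + 2 * C, by positivity, _, fun t ht =>
    ⟨hd t (by linarith), ?_⟩⟩
  have ht0 : 0 < t := by linarith
  have h0 := h.energy_nonneg n ht0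
  have h1 : 0 ≤ ∫ u in a..b, (κ (u, t) * curvDeriv a b v κ n (u, t)) ^ 2 * v (u, t) :=
    intervalIntegral.integral_nonneg h.lt.le fun _ hu =>
      mul_nonneg (sq_nonneg _) (h.speed_pos _ (mem_strip.2 ⟨hu, ht0⟩)).le
  have h2 : G * energy a b v κ n t ≤ |G| * (energy a b v κ n t + energy a b v κ n t ^ 3) :=
    mul_le_mul (le_abs_self G) (by linarith [pow_nonneg h0 3]) h0 (abs_nonneg G)
  linarith [hc t ht]

end CurvatureFlow

end Energy

/-! ### From dissipation to decay, and the induction on the order. -/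

section Decay

theorem exists_tendsto_of_antitoneOn_Ici {f : ℝ → ℝ} {T B : ℝ} (hf : AntitoneOn f (Ici T))
    (hB : ∀ t, T ≤ t → B ≤ f t) : ∃ l, Tendsto f atTop (𝓝 l) := by
  have h1 : Antitone fun t => f (max T t) := fun x y hxy =>
    hf (mem_Ici.2 (le_max_left T x)) (mem_Ici.2 (le_max_left T y)) (max_le_max_left T hxy)
  refine ⟨_, (tendsto_atTop_ciInf h1 ⟨B, ?_⟩).congr' ?_⟩
  · rintro _ ⟨t, rfl⟩
    exact hB _ (le_max_left _ _)
  · filter_upwards [eventually_ge_atTop T] with t ht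
    rw [max_eq_right ht]

/-- A nonnegative quantity `E` that is dissipated by a bounded below functional `P` and satisfies
`E' ≤ C (E + E³)` tends to zero. -/
theorem tendsto_zero_of_dissipation {P P' E E' : ℝ → ℝ} {C B T : ℝ} (hC : 0 ≤ C)
    (hP : ∀ t, T ≤ t → HasDerivAt P (P' t) t) (hP' : ∀ t, T ≤ t → P' t ≤ -E t)
    (hB : ∀ t, T ≤ t → B ≤ P t) (hE : ∀ t, T ≤ t → 0 ≤ E t)
    (hd : ∀ t, T ≤ t → HasDerivAt E (E' t) t)
    (hd' : ∀ t, T ≤ t → E' t ≤ C * (E t + E t ^ 3)) : Tendsto E atTop (𝓝 0) := by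
  obtain ⟨p, hp⟩ := exists_tendsto_of_antitoneOn_Ici (antitoneOn_Ici_of_hasDerivAt hP
    fun t ht => (hP' t ht).trans (neg_nonpos.2 (hE t ht))) hB
  -- Since `E + E³ = E (1 + E²)`, the arctangent turns the cubic growth bound into `(arctan E)' ≤ C
  -- E`, which `C P` compensates. So `arctan E` converges as a difference of convergent functions.
  have hanti : AntitoneOn (fun t => Real.arctan (E t) + C * P t) (Ici T) := by
    refine antitoneOn_Ici_of_hasDerivAt (fun t ht => (hd t ht).arctan.add ((hP t ht).const_mul C))
      fun t ht => ?_
    have h1 : 1 / (1 + E t ^ 2) * E' t ≤ C * E t := by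
      rw [one_div, inv_mul_le_iff₀ (by positivity)]
      calc _ ≤ _ := hd' t ht
        _ = _ := by ring
    nlinarith [mul_le_mul_of_nonneg_left (hP' t ht) hC]
  obtain ⟨q, hq⟩ := exists_tendsto_of_antitoneOn_Ici (B := C * B) hanti fun t ht => by
    have h1 := Real.arctan_nonneg.2 (hE t ht)
    have h2 := mul_le_mul_of_nonneg_left (hB t ht) hC
    linarith
  obtain ⟨c, hc⟩ : ∃ c, Tendsto (fun t => Real.arctan (E t)) atTop (𝓝 c) :=
    ⟨q - C * p, (hq.sub (hp.const_mul C)).congr fun t => by ring⟩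
  have hc0 : c ≤ 0 := by
    by_contra! hpos
    obtain ⟨S, hS⟩ := eventually_atTop.1 (hc.eventually (lt_mem_nhds (half_lt_self hpos)))
    have hEc : ∀ t, max S T ≤ t → c / 2 ≤ E t := fun t ht =>
      (hS t (le_of_max_le_left ht)).le.trans <| by
        have := Real.le_tan (Real.arctan_nonneg.2 (hE t (le_of_max_le_right ht)))
          (Real.arctan_lt_pi_div_two _)
        rwa [Real.tan_arctan] at this
    -- A positive limit would keep `E ≥ c/2`, so `P` would drop by at least `c/2` per unit time,
    -- contradicting its convergence.
    have h2 : AntitoneOn (fun t => P t + c / 2 * t) (Ici (max S T)) := by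
      refine antitoneOn_Ici_of_hasDerivAt (fun t ht => (hP t (le_of_max_le_right ht)).add
        ((hasDerivAt_id t).const_mul (c / 2))) fun t ht => ?_
      linarith [hEc t ht, hP' t (le_of_max_le_right ht)]
    have h3 : p ≤ p - c / 2 := by
      refine le_of_tendsto_of_tendsto (hp.comp (tendsto_atTop_add_const_right _ 1 tendsto_id))
        (hp.sub_const (c / 2)) ?_
      filter_upwards [eventually_ge_atTop (max S T)] with t ht
      have := h2 (a := t) (b := t + 1) ht (ht.trans (by simp)) (by simp)
      simp only [Function.comp, id] at this ⊢
      linarith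
    linarith
  have hc1 : 0 ≤ c := ge_of_tendsto hc <| by
    filter_upwards [eventually_ge_atTop T] with t ht using Real.arctan_nonneg.2 (hE t ht)
  have h0 : c = 0 := le_antisymm hc0 hc1
  rw [h0] at hc
  have htan : Tendsto Real.tan (𝓝 0) (𝓝 0) := by
    have := (Real.continuousAt_tan.2 (by simp : Real.cos 0 ≠ 0)).tendsto
    rwa [Real.tan_zero] at this
  exact (htan.comp hc).congr fun t => Real.tan_arctan _

namespace CurvatureFlow

variable {a b G : ℝ} {v κ : ℝ × ℝ → ℝ}

theorem tendsto_energy_of_dissipation (h : CurvatureFlow a b G v κ) (n : ℕ) {P P' : ℝ → ℝ}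
    {T B : ℝ} (hT : 1 ≤ T) (hP : ∀ t, T ≤ t → HasDerivAt P (P' t) t)
    (hP' : ∀ t, T ≤ t → P' t ≤ -energy a b v κ n t) (hB : ∀ t, T ≤ t → B ≤ P t) :
    Tendsto (energy a b v κ n) atTop (𝓝 0) := by
  obtain ⟨C, hC, E', hE'⟩ := h.exists_deriv_energy_le n
  refine tendsto_zero_of_dissipation hC hP hP' hB (fun t ht => h.energy_nonneg n (by linarith))
    (fun t ht => (hE' t (hT.trans ht)).1) fun t ht => (hE' t (hT.trans ht)).2.trans ?_
  linarith [h.energy_nonneg (n + 1) (t := t) (by linarith)]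

/-- The induction hypothesis carries a functional, not mere decay of the energy: integrability in
time is what passes to the next order. -/
theorem exists_dissipation (h : CurvatureFlow a b G v κ) (n : ℕ) :
    ∃ (T B : ℝ) (P P' : ℝ → ℝ), 1 ≤ T ∧ (∀ t, T ≤ t → HasDerivAt P (P' t) t) ∧
      (∀ t, T ≤ t → P' t ≤ -energy a b v κ n t) ∧ ∀ t, T ≤ t → B ≤ P t := by
  induction n with
  | zero => exact ⟨1, 0, length a b v, _, le_rfl, fun t ht => h.hasDerivAt_length (by linarith),
      fun t _ => le_rfl, fun t ht => h.length_nonneg (by linarith)⟩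
  | succ n ih =>
    obtain ⟨T, B, P, P', hT, hP, hP', hB⟩ := ih
    obtain ⟨C, hC, E', hE'⟩ := h.exists_deriv_energy_le n
    obtain ⟨S, hS⟩ := eventually_atTop.1
      ((h.tendsto_energy_of_dissipation n hT hP hP' hB).eventually (gt_mem_nhds one_pos))
    -- After time `S` the energy is below `1`, so `E + E³ ≤ 2E`, and `2C P' ≤ -2C E` cancels the
    -- growth, leaving `-E (n+1)`.
    refine ⟨max S T, 2 * C * B, fun t => energy a b v κ n t + 2 * C * P t, _,
      hT.trans (le_max_right _ _), fun t ht => (hE' t (hT.trans (le_of_max_le_right ht))).1.add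
        ((hP t (le_of_max_le_right ht)).const_mul (2 * C)), fun t ht => ?_, fun t ht => ?_⟩
    · have hT' := le_of_max_le_right ht
      have h0 := h.energy_nonneg n (t := t) (by linarith)
      have h1 := hS t (le_of_max_le_left ht)
      have h2 := (hE' t (hT.trans hT')).2
      have h3 := mul_le_mul_of_nonneg_left (hP' t hT') hC
      set x := energy a b v κ n t
      have h4 : x ^ 3 ≤ x := pow_le_of_le_one h0 h1.le (by norm_num)
      have h5 := mul_le_mul_of_nonneg_left h4 hC
      linarith
    · have hT' := le_of_max_le_right ht
      have h0 := h.energy_nonneg n (t := t) (by linarith)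
      have h3 := mul_le_mul_of_nonneg_left (hB t hT') hC
      linarith

theorem tendsto_energy (h : CurvatureFlow a b G v κ) (n : ℕ) :
    Tendsto (energy a b v κ n) atTop (𝓝 0) := by
  obtain ⟨T, B, P, P', hT, hP, hP', hB⟩ := h.exists_dissipation n
  exact h.tendsto_energy_of_dissipation n hT hP hP' hB

theorem eventually_abs_curvDeriv_lt (h : CurvatureFlow a b G v κ) (n : ℕ) {ε : ℝ} (hε : 0 < ε) :
    ∀ᶠ t in atTop, ∀ u ∈ Icc a b, |curvDeriv a b v κ n (u, t)| < ε := by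
  have h1 : Tendsto (fun t => length a b v 1 * energy a b v κ (n + 1) t) atTop (𝓝 0) := by
    simpa using (h.tendsto_energy (n + 1)).const_mul (length a b v 1)
  filter_upwards [h1.eventually (gt_mem_nhds (pow_pos hε 2)), eventually_ge_atTop 1]
    with t ht ht1 u hu
  have ht0 : 0 < t := by linarith
  refine abs_lt_of_sq_lt_sq (lt_of_le_of_lt (h.sq_curvDeriv_le n hu ht0)
    (lt_of_le_of_lt ?_ ht)) hε.le
  exact mul_le_mul_of_nonneg_right (h.length_le ht1) (h.energy_nonneg _ ht0)

end CurvatureFlow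

end Decay

/-! ### Linear algebra of the three ambient models. -/

namespace SpaceForm

/-- The sign of the zeroth coordinate in `form`; it is also the square of the ambient normal. -/
def sign : SpaceForm → ℝ
  | sphere => 1
  | plane => 1
  | hyperbolic => -1

/-- The derivative of the ambient normal with respect to the base point. -/
def bend : SpaceForm → ℝ
  | sphere => 1
  | plane => 0
  | hyperbolic => 1

/-- The vector product dual to `form`. -/
def cross (M : SpaceForm) (x y : Fin 3 → ℝ) : Fin 3 → ℝ :=
  ![M.sign * (x 1 * y 2 - x 2 * y 1), x 2 * y 0 - x 0 * y 2, x 0 * y 1 - x 1 * y 0]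

variable (M : SpaceForm)

theorem sign_mul_sign : M.sign * M.sign = 1 := by cases M <;> simp [sign]

theorem bend_mul_bend : M.bend * M.bend = M.bend := by cases M <;> simp [bend]

theorem form_eq (x y : Fin 3 → ℝ) :
    M.form x y = M.sign * (x 0 * y 0) + x 1 * y 1 + x 2 * y 2 := by
  cases M <;> simp [form, sign]

theorem form_comm (x y : Fin 3 → ℝ) : M.form x y = M.form y x := by
  simp only [form_eq]; ring

theorem form_add_left (x y z : Fin 3 → ℝ) : M.form (x + y) z = M.form x z + M.form y z := by
  simp only [form_eq, Pi.add_apply]; ring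

theorem form_sub_left (x y z : Fin 3 → ℝ) : M.form (x - y) z = M.form x z - M.form y z := by
  simp only [form_eq, Pi.sub_apply]; ring

theorem form_smul_left (c : ℝ) (x y : Fin 3 → ℝ) : M.form (c • x) y = c * M.form x y := by
  simp only [form_eq, Pi.smul_apply, smul_eq_mul]; ring

theorem form_smul_right (c : ℝ) (x y : Fin 3 → ℝ) : M.form x (c • y) = c * M.form x y := by
  simp only [form_eq, Pi.smul_apply, smul_eq_mul]; ring

theorem form_cross_left (x y : Fin 3 → ℝ) : M.form (M.cross x y) x = 0 := by
  have := M.sign_mul_sign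
  simp only [form_eq, cross, Matrix.cons_val]
  linear_combination (x 0 * (x 1 * y 2 - x 2 * y 1)) * this

theorem form_cross_right (x y : Fin 3 → ℝ) : M.form (M.cross x y) y = 0 := by
  have := M.sign_mul_sign
  simp only [form_eq, cross, Matrix.cons_val]
  linear_combination (y 0 * (x 1 * y 2 - x 2 * y 1)) * this

theorem form_cross_cross (x y : Fin 3 → ℝ) : M.form (M.cross x y) (M.cross x y) =
    M.sign * (M.form x x * M.form y y - M.form x y ^ 2) := by
  cases M <;> simp only [form_eq, cross, sign, Matrix.cons_val] <;> ring

theorem cross_cross (x y z : Fin 3 → ℝ) :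
    M.cross x (M.cross y z) = M.sign • (M.form x z • y - M.form x y • z) := by
  ext i
  cases M <;> fin_cases i <;> simp [form_eq, cross, sign] <;> ring

/-- By the triple product identity `w × (x × y) = 0`; applying the identity once more, to the unit
vector `x × y`, exhibits `w` as a multiple of it. -/
theorem eq_form_smul_cross {x y w : Fin 3 → ℝ} (hx : M.form x x = M.sign) (hy : M.form y y = 1)
    (hxy : M.form x y = 0) (hwx : M.form w x = 0) (hwy : M.form w y = 0) :
    w = M.form w (M.cross x y) • M.cross x y := by
  have h1 : M.cross w (M.cross x y) = 0 := by rw [cross_cross, hwx, hwy]; simp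
  have h2 : M.form (M.cross x y) (M.cross x y) = 1 := by
    rw [form_cross_cross, hx, hy, hxy]
    linear_combination M.sign_mul_sign
  have h3 := M.cross_cross (M.cross x y) w (M.cross x y)
  have h4 : M.cross (M.cross x y) 0 = 0 := by
    ext i; fin_cases i <;> simp [cross]
  rw [h1, h2, h4, one_smul] at h3
  have h5 := congrArg (fun z => M.sign • z) h3
  simp only [smul_zero, smul_smul, sign_mul_sign, one_smul] at h5
  rw [M.form_comm w]
  exact (sub_eq_zero.1 h5.symm)

theorem form_normal_normal {x : Fin 3 → ℝ} (hx : x ∈ M.carrier) :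
    M.form (M.normal x) (M.normal x) = M.sign := by
  cases M <;> simp only [form_eq, carrier, mem_ofPred_eq, normal, sign, Matrix.cons_val] at *
  · linarith
  · norm_num
  · linarith [hx.1]

/-- The metric is Riemannian. In the hyperbolic case, orthogonality to the timelike `x` and
Cauchy-Schwarz in the last two coordinates make `y` spacelike. -/
theorem form_self_pos {x y : Fin 3 → ℝ} (hx : x ∈ M.carrier) (hy : y ≠ 0)
    (hxy : M.form y (M.normal x) = 0) : 0 < M.form y y := by
  have hne : y 0 ≠ 0 ∨ y 1 ≠ 0 ∨ y 2 ≠ 0 := by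
    by_contra! h
    exact hy (by ext i; fin_cases i <;> simp [h])
  have hpos : 0 < y 0 ^ 2 + y 1 ^ 2 + y 2 ^ 2 := by
    rcases hne with h | h | h <;> positivity
  cases M <;> simp only [form_eq, carrier, mem_ofPred_eq, normal, sign] at *
  · linarith
  · linarith
  · obtain ⟨hx1, hx0⟩ := hx
    have h1 : (x 0 * y 0) ^ 2 ≤ (x 1 ^ 2 + x 2 ^ 2) * (y 1 ^ 2 + y 2 ^ 2) := by
      have : x 0 * y 0 = x 1 * y 1 + x 2 * y 2 := by linarith
      rw [this]
      linarith [sq_nonneg (x 1 * y 2 - x 2 * y 1)]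
    have h2 : x 1 ^ 2 + x 2 ^ 2 = x 0 ^ 2 - 1 := by linarith
    rw [h2] at h1
    have h3 : 0 < x 0 ^ 2 := by positivity
    have h4 : 0 < y 1 ^ 2 + y 2 ^ 2 := by
      by_contra! h
      have h5 : y 1 ^ 2 + y 2 ^ 2 = 0 := le_antisymm h (by positivity)
      rw [h5, mul_zero, mul_pow] at h1
      nlinarith
    have h6 : x 0 ^ 2 * (y 0 ^ 2 - (y 1 ^ 2 + y 2 ^ 2)) < 0 := by nlinarith
    nlinarith [(pos_iff_neg_of_mul_neg h6).1 h3]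

theorem hasDerivWithinAt_form {X Y : ℝ → Fin 3 → ℝ} {X' Y' : Fin 3 → ℝ} {s : Set ℝ} {x : ℝ}
    (hX : HasDerivWithinAt X X' s x) (hY : HasDerivWithinAt Y Y' s x) :
    HasDerivWithinAt (fun r => M.form (X r) (Y r)) (M.form X' (Y x) + M.form (X x) Y') s x := by
  rw [hasDerivWithinAt_pi] at hX hY
  simp only [form_eq]
  refine (((((hX 0).mul (hY 0)).const_mul M.sign).add ((hX 1).mul (hY 1))).add
    ((hX 2).mul (hY 2))).congr_deriv ?_
  ring

theorem hasDerivWithinAt_normal {X : ℝ → Fin 3 → ℝ} {X' : Fin 3 → ℝ} {s : Set ℝ} {x : ℝ}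
    (hX : HasDerivWithinAt X X' s x) :
    HasDerivWithinAt (fun r => M.normal (X r)) (M.bend • X') s x := by
  cases M
  · simpa [normal, bend] using hX
  · simpa [normal, bend] using hasDerivWithinAt_const x s (![1, 0, 0] : Fin 3 → ℝ)
  · simpa [normal, bend] using hX

theorem form_deriv_normal {X : ℝ → Fin 3 → ℝ} {X' : Fin 3 → ℝ} {s : Set ℝ} {x : ℝ}
    (hs : UniqueDiffWithinAt ℝ s x) (hx : x ∈ s) (hmem : ∀ r ∈ s, X r ∈ M.carrier)
    (hX : HasDerivWithinAt X X' s x) : M.form X' (M.normal (X x)) = 0 := by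
  have hself : ∀ c : ℝ, (∀ r ∈ s, M.form (X r) (X r) = c) → M.form X' (X x) = 0 := by
    intro c hc
    have h1 := hs.eq_deriv _ (M.hasDerivWithinAt_form hX hX)
      ((hasDerivWithinAt_const x s c).congr hc (hc x hx))
    rw [M.form_comm (X x)] at h1
    linarith
  cases M
  · exact hself 1 fun r hr => SpaceForm.form_normal_normal sphere (hmem r hr)
  · have h1 := hs.eq_deriv _ ((hasDerivWithinAt_pi.1 hX) 0)
      ((hasDerivWithinAt_const x s (0 : ℝ)).congr (fun r hr => hmem r hr) (hmem x hx))
    simp [form_eq, normal, sign, h1]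
  · exact hself (-1) fun r hr => SpaceForm.form_normal_normal hyperbolic (hmem r hr)

end SpaceForm

/-! ### Product rules for vector fields on the strip. -/

section VectorCalculus

variable {a b : ℝ} {M : SpaceForm} {f : ℝ × ℝ → ℝ} {X Y : ℝ × ℝ → Fin 3 → ℝ}

theorem SmoothOn.form (hX : SmoothOn a b X) (hY : SmoothOn a b Y) :
    SmoothOn a b (fun p => M.form (X p) (Y p)) := by
  have hX := contDiffOn_pi.1 hX
  have hY := contDiffOn_pi.1 hY
  simp only [SpaceForm.form_eq]
  exact ((contDiffOn_const.mul ((hX 0).mul (hY 0))).add ((hX 1).mul (hY 1))).add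
    ((hX 2).mul (hY 2))

theorem SmoothOn.normal (hX : SmoothOn a b X) : SmoothOn a b (fun p => M.normal (X p)) := by
  cases M
  · exact hX
  · exact contDiffOn_const
  · exact hX

theorem SmoothOn.cross (hX : SmoothOn a b X) (hY : SmoothOn a b Y) :
    SmoothOn a b (fun p => M.cross (X p) (Y p)) := by
  have hX := contDiffOn_pi.1 hX
  have hY := contDiffOn_pi.1 hY
  refine contDiffOn_pi.2 fun i => ?_
  fin_cases i
  · exact contDiffOn_const.mul (((hX 1).mul (hY 2)).sub ((hX 2).mul (hY 1)))
  · exact ((hX 2).mul (hY 0)).sub ((hX 0).mul (hY 2))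
  · exact ((hX 0).mul (hY 1)).sub ((hX 1).mul (hY 0))

theorem SmoothOn.du_form (hab : a < b) (hX : SmoothOn a b X) (hY : SmoothOn a b Y) {p : ℝ × ℝ}
    (hp : p ∈ strip a b) : Du a b (fun q => M.form (X q) (Y q)) p =
      M.form (Du a b X p) (Y p) + M.form (X p) (Du a b Y p) :=
  (hX.form hY).du_eq hab hp.1 hp.2 (M.hasDerivWithinAt_form (hX.hasDerivWithinAt_du hp.1 hp.2)
    (hY.hasDerivWithinAt_du hp.1 hp.2))

theorem SmoothOn.dt_form (hX : SmoothOn a b X) (hY : SmoothOn a b Y) {p : ℝ × ℝ}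
    (hp : p ∈ strip a b) : Dt a b (fun q => M.form (X q) (Y q)) p =
      M.form (Dt a b X p) (Y p) + M.form (X p) (Dt a b Y p) :=
  (hX.form hY).dt_eq hp.1 hp.2 (hasDerivWithinAt_univ.1 (M.hasDerivWithinAt_form
    (hX.hasDerivAt_dt hp.1 hp.2).hasDerivWithinAt (hY.hasDerivAt_dt hp.1 hp.2).hasDerivWithinAt))

theorem du_const {E : Type*} [NormedAddCommGroup E] [NormedSpace ℝ E] (c : E) (p : ℝ × ℝ) :
    Du a b (fun _ => c) p = 0 := by
  simp [Du]

theorem dt_const {E : Type*} [NormedAddCommGroup E] [NormedSpace ℝ E] (c : E) (p : ℝ × ℝ) :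
    Dt a b (fun _ => c) p = 0 := by
  simp [Dt]

theorem SmoothOn.form_du_of_const (hab : a < b) (hX : SmoothOn a b X) (hY : SmoothOn a b Y)
    {c : ℝ} (hc : ∀ p ∈ strip a b, M.form (X p) (Y p) = c) {p : ℝ × ℝ} (hp : p ∈ strip a b) :
    M.form (Du a b X p) (Y p) = -M.form (X p) (Du a b Y p) := by
  have h1 := hX.du_form (M := M) hab hY hp
  rw [du_congr (g := fun _ => c) hc hp, du_const] at h1
  linarith

theorem SmoothOn.form_dt_of_const (hX : SmoothOn a b X) (hY : SmoothOn a b Y)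
    {c : ℝ} (hc : ∀ p ∈ strip a b, M.form (X p) (Y p) = c) {p : ℝ × ℝ} (hp : p ∈ strip a b) :
    M.form (Dt a b X p) (Y p) = -M.form (X p) (Dt a b Y p) := by
  have h1 := hX.dt_form (M := M) hY hp
  rw [dt_congr (g := fun _ => c) hc hp, dt_const] at h1
  linarith

theorem SmoothOn.du_smul (hab : a < b) (hf : SmoothOn a b f) (hX : SmoothOn a b X) {p : ℝ × ℝ}
    (hp : p ∈ strip a b) :
    Du a b (fun q => f q • X q) p = f p • Du a b X p + Du a b f p • X p :=
  SmoothOn.du_eq hab (ContDiffOn.smul hf hX) hp.1 hp.2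
    ((hf.hasDerivWithinAt_du hp.1 hp.2).smul (hX.hasDerivWithinAt_du hp.1 hp.2))

theorem SmoothOn.dt_smul (hf : SmoothOn a b f) (hX : SmoothOn a b X) {p : ℝ × ℝ}
    (hp : p ∈ strip a b) :
    Dt a b (fun q => f q • X q) p = f p • Dt a b X p + Dt a b f p • X p :=
  SmoothOn.dt_eq (ContDiffOn.smul hf hX) hp.1 hp.2
    ((hf.hasDerivAt_dt hp.1 hp.2).smul (hX.hasDerivAt_dt hp.1 hp.2))

end VectorCalculus

/-! ### The moving frame, the evolution equations and the link with the given curvature. -/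

section Frame

/-- The family of curves as a map on space-time. -/
def surf (F : ℝ → ℝ → Fin 3 → ℝ) (p : ℝ × ℝ) : Fin 3 → ℝ := F p.1 p.2

/-- The velocity `∂F/∂u` on space-time. -/
noncomputable def vel (a b : ℝ) (F : ℝ → ℝ → Fin 3 → ℝ) : ℝ × ℝ → Fin 3 → ℝ :=
  Du a b (surf F)

/-- The speed on space-time. -/
noncomputable def spd (M : SpaceForm) (a b : ℝ) (F : ℝ → ℝ → Fin 3 → ℝ) (p : ℝ × ℝ) : ℝ :=
  Real.sqrt (M.form (vel a b F p) (vel a b F p))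

/-- The unit tangent on space-time. -/
noncomputable def tang (M : SpaceForm) (a b : ℝ) (F : ℝ → ℝ → Fin 3 → ℝ) (p : ℝ × ℝ) :
    Fin 3 → ℝ := (spd M a b F p)⁻¹ • vel a b F p

/-- The normal of the surface along the curves. -/
noncomputable def nu (M : SpaceForm) (F : ℝ → ℝ → Fin 3 → ℝ) (p : ℝ × ℝ) : Fin 3 → ℝ :=
  M.normal (surf F p)

/-- The unit normal of the curves obtained by rotating the unit tangent. -/
noncomputable def nrm (M : SpaceForm) (a b : ℝ) (F : ℝ → ℝ → Fin 3 → ℝ) (p : ℝ × ℝ) :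
    Fin 3 → ℝ := M.cross (nu M F p) (tang M a b F p)

/-- The curvature with respect to the rotated unit normal `nrm`. -/
noncomputable def curv (M : SpaceForm) (a b : ℝ) (F : ℝ → ℝ → Fin 3 → ℝ) (p : ℝ × ℝ) : ℝ :=
  (spd M a b F p)⁻¹ * M.form (Du a b (tang M a b F) p) (nrm M a b F p)

namespace IsGlobalSolution

variable {M : SpaceForm} {a b : ℝ} {A B : Fin 3 → ℝ} {F : ℝ → ℝ → Fin 3 → ℝ}
  {p : ℝ × ℝ}

theorem smooth_surf (hF : IsGlobalSolution M a b A B F) : SmoothOn a b (surf F) := hF.smooth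

theorem smooth_vel (hF : IsGlobalSolution M a b A B F) (hab : a < b) :
    SmoothOn a b (vel a b F) := hF.smooth_surf.du hab

theorem mem_surf (hF : IsGlobalSolution M a b A B F) (hp : p ∈ strip a b) :
    surf F p ∈ M.carrier := hF.mem_carrier p.1 hp.1 p.2 (le_of_lt hp.2)

theorem velocity_eq (hF : IsGlobalSolution M a b A B F) (hab : a < b) {u t : ℝ}
    (hu : u ∈ Icc a b) (ht : 0 < t) : velocity a b F t u = vel a b F (u, t) :=
  (hF.smooth_surf.hasDerivWithinAt_du hu ht).derivWithin (uniqueDiffOn_Icc hab u hu)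

theorem form_vel_nu (hF : IsGlobalSolution M a b A B F) (hab : a < b) (hp : p ∈ strip a b) :
    M.form (vel a b F p) (nu M F p) = 0 :=
  M.form_deriv_normal (X := fun x => surf F (x, p.2)) (uniqueDiffOn_Icc hab p.1 hp.1) hp.1
    (fun _ hr => hF.mem_surf (mem_strip.2 ⟨hr, hp.2⟩))
    (hF.smooth_surf.hasDerivWithinAt_du hp.1 hp.2)

theorem form_vel_vel_pos (hF : IsGlobalSolution M a b A B F) (hab : a < b)
    (hp : p ∈ strip a b) : 0 < M.form (vel a b F p) (vel a b F p) := by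
  refine M.form_self_pos (hF.mem_surf hp) ?_ (hF.form_vel_nu hab hp)
  have := hF.immersed p.1 hp.1 p.2 hp.2
  rwa [hF.velocity_eq hab hp.1 hp.2] at this

theorem spd_pos (hF : IsGlobalSolution M a b A B F) (hab : a < b) (hp : p ∈ strip a b) :
    0 < spd M a b F p := Real.sqrt_pos.2 (hF.form_vel_vel_pos hab hp)

theorem spd_mul_spd (hF : IsGlobalSolution M a b A B F) (hab : a < b) (hp : p ∈ strip a b) :
    spd M a b F p * spd M a b F p = M.form (vel a b F p) (vel a b F p) :=
  Real.mul_self_sqrt (hF.form_vel_vel_pos hab hp).le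

theorem smooth_spd (hF : IsGlobalSolution M a b A B F) (hab : a < b) :
    SmoothOn a b (spd M a b F) :=
  ContDiffOn.sqrt ((hF.smooth_vel hab).form (hF.smooth_vel hab))
    fun _ hp => (hF.form_vel_vel_pos hab hp).ne'

theorem smooth_inv_spd (hF : IsGlobalSolution M a b A B F) (hab : a < b) :
    SmoothOn a b (fun p => (spd M a b F p)⁻¹) :=
  ContDiffOn.inv (hF.smooth_spd hab) fun _ hp => (hF.spd_pos hab hp).ne'

theorem smooth_tang (hF : IsGlobalSolution M a b A B F) (hab : a < b) :
    SmoothOn a b (tang M a b F) :=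
  ContDiffOn.smul (hF.smooth_inv_spd hab) (hF.smooth_vel hab)

theorem smooth_nu (hF : IsGlobalSolution M a b A B F) : SmoothOn a b (nu M F) :=
  hF.smooth_surf.normal

theorem smooth_nrm (hF : IsGlobalSolution M a b A B F) (hab : a < b) :
    SmoothOn a b (nrm M a b F) := hF.smooth_nu.cross (hF.smooth_tang hab)

theorem smooth_curv (hF : IsGlobalSolution M a b A B F) (hab : a < b) :
    SmoothOn a b (curv M a b F) :=
  ContDiffOn.mul (hF.smooth_inv_spd hab) (((hF.smooth_tang hab).du hab).form (hF.smooth_nrm hab))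

theorem vel_eq (hF : IsGlobalSolution M a b A B F) (hab : a < b) (hp : p ∈ strip a b) :
    vel a b F p = spd M a b F p • tang M a b F p := by
  rw [tang, smul_smul, mul_inv_cancel₀ (hF.spd_pos hab hp).ne', one_smul]

theorem form_nu_nu (hF : IsGlobalSolution M a b A B F) (hp : p ∈ strip a b) :
    M.form (nu M F p) (nu M F p) = M.sign := M.form_normal_normal (hF.mem_surf hp)

theorem form_tang_tang (hF : IsGlobalSolution M a b A B F) (hab : a < b) (hp : p ∈ strip a b) :
    M.form (tang M a b F p) (tang M a b F p) = 1 := by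
  have hv := (hF.spd_pos hab hp).ne'
  rw [tang, M.form_smul_left, M.form_smul_right, ← hF.spd_mul_spd hab hp]
  field_simp

theorem form_nu_tang (hF : IsGlobalSolution M a b A B F) (hab : a < b) (hp : p ∈ strip a b) :
    M.form (nu M F p) (tang M a b F p) = 0 := by
  rw [tang, M.form_smul_right, M.form_comm, hF.form_vel_nu hab hp, mul_zero]

theorem form_nrm_nu : M.form (nrm M a b F p) (nu M F p) = 0 := M.form_cross_left _ _

theorem form_nrm_tang : M.form (nrm M a b F p) (tang M a b F p) = 0 := M.form_cross_right _ _

theorem form_nrm_nrm (hF : IsGlobalSolution M a b A B F) (hab : a < b) (hp : p ∈ strip a b) :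
    M.form (nrm M a b F p) (nrm M a b F p) = 1 := by
  rw [nrm, M.form_cross_cross, hF.form_nu_nu hp, hF.form_tang_tang hab hp,
    hF.form_nu_tang hab hp]
  linear_combination M.sign_mul_sign

theorem eq_form_smul_nrm (hF : IsGlobalSolution M a b A B F) (hab : a < b) (hp : p ∈ strip a b)
    {w : Fin 3 → ℝ} (h1 : M.form w (nu M F p) = 0) (h2 : M.form w (tang M a b F p) = 0) :
    w = M.form w (nrm M a b F p) • nrm M a b F p :=
  M.eq_form_smul_cross (hF.form_nu_nu hp) (hF.form_tang_tang hab hp) (hF.form_nu_tang hab hp) h1 h2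

theorem du_nu (hF : IsGlobalSolution M a b A B F) (hab : a < b) (hp : p ∈ strip a b) :
    Du a b (nu M F) p = (M.bend * spd M a b F p) • tang M a b F p := by
  rw [hF.smooth_nu.du_eq hab hp.1 hp.2
    (M.hasDerivWithinAt_normal (hF.smooth_surf.hasDerivWithinAt_du hp.1 hp.2)), mul_smul,
    ← hF.vel_eq hab hp]
  rfl

theorem dt_nu (hF : IsGlobalSolution M a b A B F) (hp : p ∈ strip a b) :
    Dt a b (nu M F) p = M.bend • Dt a b (surf F) p :=
  hF.smooth_nu.dt_eq hp.1 hp.2 (hasDerivWithinAt_univ.1 (M.hasDerivWithinAt_normal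
    (hF.smooth_surf.hasDerivAt_dt hp.1 hp.2).hasDerivWithinAt))

theorem form_du_tang_nrm (hF : IsGlobalSolution M a b A B F) (hab : a < b)
    (hp : p ∈ strip a b) : M.form (Du a b (tang M a b F) p) (nrm M a b F p) =
      spd M a b F p * curv M a b F p := by
  rw [curv, mul_inv_cancel_left₀ (hF.spd_pos hab hp).ne']

/-- The Frenet equation for the unit tangent. -/
theorem du_tang (hF : IsGlobalSolution M a b A B F) (hab : a < b) (hp : p ∈ strip a b) :
    Du a b (tang M a b F) p = spd M a b F p •
      (curv M a b F p • nrm M a b F p - (M.bend * M.sign) • nu M F p) := by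
  have hT := hF.smooth_tang hab
  have h1 : M.form (Du a b (tang M a b F) p) (nu M F p) = -(M.bend * spd M a b F p) := by
    rw [hT.form_du_of_const hab hF.smooth_nu (c := 0)
      (fun q hq => by rw [M.form_comm, hF.form_nu_tang hab hq]) hp, hF.du_nu hab hp,
      M.form_smul_right, hF.form_tang_tang hab hp, mul_one]
  have h2 : M.form (Du a b (tang M a b F) p) (tang M a b F p) = 0 := by
    have := hT.form_du_of_const hab hT (fun q hq => hF.form_tang_tang hab hq) hp
    rw [M.form_comm (tang M a b F p)] at this
    linarith
  -- Cancelling the known component along `nu` leaves a vector orthogonal to `nu` and `tang`, hence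
  -- a multiple of `nrm`.
  have h3 := hF.eq_form_smul_nrm hab hp
    (w := Du a b (tang M a b F) p + (spd M a b F p * (M.bend * M.sign)) • nu M F p)
    (by rw [M.form_add_left, M.form_smul_left, h1, hF.form_nu_nu hp]
        linear_combination (M.bend * spd M a b F p) * M.sign_mul_sign)
    (by rw [M.form_add_left, M.form_smul_left, h2, hF.form_nu_tang hab hp]; ring)
  rw [M.form_add_left, M.form_smul_left, M.form_comm (nu M F p), form_nrm_nu, mul_zero, add_zero,
    hF.form_du_tang_nrm hab hp] at h3
  rw [smul_sub, smul_smul, smul_smul, ← h3, add_sub_cancel_right]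

/-- The Frenet equation for the unit normal. -/
theorem du_nrm (hF : IsGlobalSolution M a b A B F) (hab : a < b) (hp : p ∈ strip a b) :
    Du a b (nrm M a b F) p = -(spd M a b F p * curv M a b F p) • tang M a b F p := by
  have hN := hF.smooth_nrm hab
  have h1 : M.form (Du a b (nrm M a b F) p) (nu M F p) = 0 := by
    rw [hN.form_du_of_const hab hF.smooth_nu (fun q _ => form_nrm_nu) hp, hF.du_nu hab hp,
      M.form_smul_right, form_nrm_tang, mul_zero, neg_zero]
  have h2 : M.form (Du a b (nrm M a b F) p) (tang M a b F p) =
      -(spd M a b F p * curv M a b F p) := by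
    rw [hN.form_du_of_const hab (hF.smooth_tang hab) (fun q _ => form_nrm_tang) hp,
      M.form_comm, hF.form_du_tang_nrm hab hp]
  have h3 : M.form (Du a b (nrm M a b F) p) (nrm M a b F p) = 0 := by
    have := hN.form_du_of_const hab hN (fun q hq => hF.form_nrm_nrm hab hq) hp
    rw [M.form_comm (nrm M a b F p)] at this
    linarith
  have h4 := hF.eq_form_smul_nrm hab hp
    (w := Du a b (nrm M a b F) p + (spd M a b F p * curv M a b F p) • tang M a b F p)
    (by rw [M.form_add_left, M.form_smul_left, h1, M.form_comm (tang M a b F p),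
          hF.form_nu_tang hab hp]; ring)
    (by rw [M.form_add_left, M.form_smul_left, h2, hF.form_tang_tang hab hp]; ring)
  rw [M.form_add_left, M.form_smul_left, h3, M.form_comm (tang M a b F p), form_nrm_tang,
    mul_zero, add_zero, zero_smul] at h4
  rw [neg_smul]
  exact eq_neg_of_add_eq_zero_left h4

theorem speed_eq (hF : IsGlobalSolution M a b A B F) (hab : a < b) {u t : ℝ}
    (hu : u ∈ Icc a b) (ht : 0 < t) : speed M a b F t u = spd M a b F (u, t) := by
  rw [speed, hF.velocity_eq hab hu ht]; rfl

theorem unitTangent_eq (hF : IsGlobalSolution M a b A B F) (hab : a < b) {u t : ℝ}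
    (hu : u ∈ Icc a b) (ht : 0 < t) : unitTangent M a b F t u = tang M a b F (u, t) := by
  rw [unitTangent, hF.velocity_eq hab hu ht, hF.speed_eq hab hu ht]; rfl

theorem derivWithin_eq {E : Type*} [NormedAddCommGroup E] [NormedSpace ℝ E] (hab : a < b)
    {f : ℝ × ℝ → E} (hf : SmoothOn a b f) {g : ℝ → E} {u t : ℝ} (hu : u ∈ Icc a b) (ht : 0 < t)
    (hg : ∀ x ∈ Icc a b, g x = f (x, t)) : derivWithin g (Icc a b) u = Du a b f (u, t) := by
  rw [derivWithin_congr hg (hg u hu)]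
  exact (hf.hasDerivWithinAt_du hu ht).derivWithin (uniqueDiffOn_Icc hab u hu)

theorem curvatureVector_eq (hF : IsGlobalSolution M a b A B F) (hab : a < b) {u t : ℝ}
    (hu : u ∈ Icc a b) (ht : 0 < t) :
    curvatureVector M a b F t u = curv M a b F (u, t) • nrm M a b F (u, t) := by
  have hp := mem_strip.2 ⟨hu, ht⟩
  rw [curvatureVector, derivWithin_eq hab (hF.smooth_tang hab) hu ht
    (fun x hx => hF.unitTangent_eq hab hx ht), hF.speed_eq hab hu ht, hF.du_tang hab hp,
    inv_smul_smul₀ (hF.spd_pos hab hp).ne', SpaceForm.tangentProj]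
  change _ - (M.form _ (nu M F (u, t)) / M.form (nu M F (u, t)) (nu M F (u, t))) • nu M F (u, t) = _
  have hs : M.sign ≠ 0 := fun h => by simpa [h] using M.sign_mul_sign
  rw [hF.form_nu_nu hp, M.form_sub_left, M.form_smul_left, M.form_smul_left, form_nrm_nu,
    hF.form_nu_nu hp]
  have : (curv M a b F (u, t) * 0 - M.bend * M.sign * M.sign) / M.sign = -(M.bend * M.sign) := by
    field_simp; ring
  rw [this, neg_smul, sub_neg_eq_add, sub_add_cancel]

theorem dt_surf (hF : IsGlobalSolution M a b A B F) (hab : a < b) (hp : p ∈ strip a b) :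
    Dt a b (surf F) p = curv M a b F p • nrm M a b F p := by
  rw [← hF.curvatureVector_eq hab hp.1 hp.2]
  exact hF.smooth_surf.dt_eq hp.1 hp.2 (hF.flow p.1 hp.1 p.2 hp.2)

/-- Mixed partials commute, so this is the `u`-derivative of `κ N`, computed by Frenet. -/
theorem dt_vel (hF : IsGlobalSolution M a b A B F) (hab : a < b) (hp : p ∈ strip a b) :
    Dt a b (vel a b F) p = Du a b (curv M a b F) p • nrm M a b F p -
      (spd M a b F p * curv M a b F p ^ 2) • tang M a b F p := by
  rw [vel, ← hF.smooth_surf.du_dt hab hp,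
    du_congr (g := fun q => curv M a b F q • nrm M a b F q) (fun q hq => hF.dt_surf hab hq) hp,
    (hF.smooth_curv hab).du_smul hab (hF.smooth_nrm hab) hp, hF.du_nrm hab hp, smul_smul]
  rw [add_comm, sub_eq_add_neg, ← neg_smul]
  congr 2
  ring

theorem dt_spd (hF : IsGlobalSolution M a b A B F) (hab : a < b) (hp : p ∈ strip a b) :
    Dt a b (spd M a b F) p = -(curv M a b F p ^ 2 * spd M a b F p) := by
  have hv := hF.smooth_spd hab
  have h1 := (hF.smooth_vel hab).dt_form (M := M) (hF.smooth_vel hab) hp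
  have h2 : Dt a b (fun q => spd M a b F q * spd M a b F q) p =
      Dt a b (spd M a b F) p * spd M a b F p + spd M a b F p * Dt a b (spd M a b F) p :=
    SmoothOn.dt_eq (ContDiffOn.mul hv hv) hp.1 hp.2
      ((hv.hasDerivAt_dt hp.1 hp.2).mul (hv.hasDerivAt_dt hp.1 hp.2))
  rw [dt_congr (g := fun q => M.form (vel a b F q) (vel a b F q))
    (fun q hq => hF.spd_mul_spd hab hq) hp, h1, M.form_comm (vel a b F p), hF.dt_vel hab hp,
    hF.vel_eq hab hp, M.form_smul_right, M.form_sub_left, M.form_smul_left, M.form_smul_left,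
    form_nrm_tang, hF.form_tang_tang hab hp] at h2
  have h3 := hF.spd_pos hab hp
  refine mul_left_cancel₀ h3.ne' ?_
  linear_combination -h2 / 2

theorem dt_inv_spd (hF : IsGlobalSolution M a b A B F) (hab : a < b) (hp : p ∈ strip a b) :
    Dt a b (fun q => (spd M a b F q)⁻¹) p = curv M a b F p ^ 2 * (spd M a b F p)⁻¹ := by
  have hv := (hF.spd_pos hab hp).ne'
  rw [(hF.smooth_inv_spd hab).dt_eq hp.1 hp.2
    (((hF.smooth_spd hab).hasDerivAt_dt hp.1 hp.2).inv hv), hF.dt_spd hab hp]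
  field_simp

theorem dt_tang (hF : IsGlobalSolution M a b A B F) (hab : a < b) (hp : p ∈ strip a b) :
    Dt a b (tang M a b F) p = Ds a b (spd M a b F) (curv M a b F) p • nrm M a b F p := by
  have hv := (hF.spd_pos hab hp).ne'
  have h1 := (hF.smooth_inv_spd hab).dt_smul (hF.smooth_vel hab) hp
  change Dt a b (tang M a b F) p = _ at h1
  rw [h1, hF.dt_vel hab hp, hF.dt_inv_spd hab hp, hF.vel_eq hab hp, Ds, smul_sub, smul_smul,
    smul_smul, smul_smul, sub_add_eq_add_sub, add_sub_assoc, ← sub_smul]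
  have : curv M a b F p ^ 2 * (spd M a b F p)⁻¹ * spd M a b F p -
      (spd M a b F p)⁻¹ * (spd M a b F p * curv M a b F p ^ 2) = 0 := by
    field_simp; ring
  rw [this, zero_smul, add_zero]

/-- Differentiate `κ = v⁻¹ ⟨∂ᵤT, N⟩`. The diffusion comes from `∂ₜT = κₛ N`, the cubic term from
`v⁻¹`, and the Gaussian curvature `bend * sign` from pairing the `nu` component of `∂ᵤT` with `∂ₜN`.
-/
theorem dt_curv (hF : IsGlobalSolution M a b A B F) (hab : a < b) (hp : p ∈ strip a b) :
    Dt a b (curv M a b F) p = Ds a b (spd M a b F) (Ds a b (spd M a b F) (curv M a b F)) p +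
      M.bend * M.sign * curv M a b F p + curv M a b F p * curv M a b F p * curv M a b F p := by
  have hv := (hF.spd_pos hab hp).ne'
  have sT := hF.smooth_tang hab
  have sN := hF.smooth_nrm hab
  have sDs : SmoothOn a b (Ds a b (spd M a b F) (curv M a b F)) :=
    ContDiffOn.mul (hF.smooth_inv_spd hab) ((hF.smooth_curv hab).du hab)
  have h1 : Dt a b (Du a b (tang M a b F)) p =
      Ds a b (spd M a b F) (curv M a b F) p • (-(spd M a b F p * curv M a b F p) •
        tang M a b F p) +
      Du a b (Ds a b (spd M a b F) (curv M a b F)) p • nrm M a b F p := by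
    rw [← sT.du_dt hab hp, du_congr (g := fun q => Ds a b (spd M a b F) (curv M a b F) q •
      nrm M a b F q) (fun q hq => hF.dt_tang hab hq) hp, sDs.du_smul hab sN hp, hF.du_nrm hab hp]
  have h2 : M.form (nu M F p) (Dt a b (nrm M a b F) p) = -(M.bend * curv M a b F p) := by
    have h := sN.form_dt_of_const hF.smooth_nu (fun q _ => form_nrm_nu) hp
    rw [hF.dt_nu hp, hF.dt_surf hab hp, M.form_smul_right, M.form_smul_right,
      hF.form_nrm_nrm hab hp, mul_one] at h
    rw [M.form_comm, h]
  have h3 : M.form (nrm M a b F p) (Dt a b (nrm M a b F) p) = 0 := by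
    have := sN.form_dt_of_const sN (fun q hq => hF.form_nrm_nrm hab hq) hp
    rw [M.form_comm (Dt a b (nrm M a b F) p)] at this
    linarith
  have h4 : Dt a b (curv M a b F) p = _ := (hF.smooth_curv hab).dt_eq hp.1 hp.2
    (((hF.smooth_inv_spd hab).hasDerivAt_dt hp.1 hp.2).mul
      (((sT.du hab).form (M := M) sN).hasDerivAt_dt hp.1 hp.2))
  have hds : Ds a b (spd M a b F) (Ds a b (spd M a b F) (curv M a b F)) p =
    (spd M a b F p)⁻¹ * Du a b (Ds a b (spd M a b F) (curv M a b F)) p := rfl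
  rw [h4, hF.dt_inv_spd hab hp, (sT.du hab).dt_form sN hp, h1, hF.du_tang hab hp, M.form_add_left,
    M.form_smul_left, M.form_smul_left, M.form_smul_left, M.form_smul_left, M.form_smul_left,
    M.form_sub_left, M.form_sub_left, M.form_smul_left, M.form_smul_left, M.form_smul_left,
    M.form_smul_left, h2, h3, hF.form_nrm_nrm hab hp, M.form_comm (tang M a b F p), form_nrm_tang,
    M.form_comm (nu M F p), form_nrm_nu, hds]
  field_simp
  linear_combination (spd M a b F p * curv M a b F p * M.sign) * M.bend_mul_bend

/-- A fixed point has zero velocity, and that velocity is `κ N` with `N` a unit vector. -/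
theorem curv_eq_zero_of_const (hF : IsGlobalSolution M a b A B F) (hab : a < b) {e : ℝ}
    (he : e ∈ Icc a b) {c : Fin 3 → ℝ} (hc : ∀ t, 0 ≤ t → F e t = c) {t : ℝ} (ht : 0 < t) :
    curv M a b F (e, t) = 0 := by
  have hp := mem_strip.2 ⟨he, ht⟩
  have h1 : Dt a b (surf F) (e, t) = 0 := by
    refine hF.smooth_surf.dt_eq he ht ((hasDerivAt_const t c).congr_of_eventuallyEq ?_)
    filter_upwards [Ioi_mem_nhds ht] with τ hτ
    exact hc τ (le_of_lt hτ)
  rw [hF.dt_surf hab hp] at h1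
  have h2 := congrArg (fun w => M.form w (nrm M a b F (e, t))) h1
  rw [M.form_smul_left, hF.form_nrm_nrm hab hp, mul_one] at h2
  rw [h2]
  simp [M.form_eq]

theorem curvatureFlow (hF : IsGlobalSolution M a b A B F) (hab : a < b) :
    CurvatureFlow a b (M.bend * M.sign) (spd M a b F) (curv M a b F) where
  lt := hab
  smooth_speed := hF.smooth_spd hab
  smooth_curv := hF.smooth_curv hab
  speed_pos _ hp := hF.spd_pos hab hp
  dt_speed _ hp := hF.dt_spd hab hp
  dt_curv _ hp := hF.dt_curv hab hp
  left _ ht := hF.curv_eq_zero_of_const hab (left_mem_Icc.2 hab.le) hF.left_endpoint ht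
  right _ ht := hF.curv_eq_zero_of_const hab (right_mem_Icc.2 hab.le) hF.right_endpoint ht

theorem iterate_arcDeriv (hF : IsGlobalSolution M a b A B F) (hab : a < b) {t c : ℝ} (ht : 0 < t)
    {f : ℝ → ℝ} (hf : ∀ u ∈ Icc a b, f u = c * curv M a b F (u, t)) (n : ℕ) :
    ∀ u ∈ Icc a b, (arcDeriv M a b F t)^[n] f u =
      c * curvDeriv a b (spd M a b F) (curv M a b F) n (u, t) := by
  induction n with
  | zero => exact hf
  | succ n ih =>
    intro u hu
    have hs : SmoothOn a b (fun p => c * curvDeriv a b (spd M a b F) (curv M a b F) n p) :=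
      contDiffOn_const.mul ((hF.curvatureFlow hab).smooth_curvDeriv n)
    rw [Function.iterate_succ_apply', arcDeriv, derivWithin_eq hab hs hu ht ih,
      hF.speed_eq hab hu ht, curvDeriv_succ, ← (hF.curvatureFlow hab).ds_const_mul c
        ((hF.curvatureFlow hab).smooth_curvDeriv n) (mem_strip.2 ⟨hu, ht⟩)]
    rfl

/-- Any unit normal field differs from the rotated unit tangent by a constant sign. -/
theorem exists_curvature_eq (hF : IsGlobalSolution M a b A B F) (hab : a < b)
    {N : ℝ → ℝ → Fin 3 → ℝ} (hN : IsUnitNormal M a b F N) {t : ℝ} (ht : 0 < t) :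
    ∃ c : ℝ, |c| = 1 ∧ ∀ u ∈ Icc a b, curvature M a b F N t u = c * curv M a b F (u, t) := by
  set φ : ℝ → ℝ := fun u => M.form (N u t) (nrm M a b F (u, t)) with hφ
  have hcurv : ∀ u ∈ Icc a b, curvature M a b F N t u = φ u * curv M a b F (u, t) := by
    intro u hu
    rw [curvature, hF.curvatureVector_eq hab hu ht, M.form_smul_left, M.form_comm, mul_comm]
  have hsq : ∀ u ∈ Icc a b, φ u ^ 2 = 1 := by
    intro u hu
    have hp := mem_strip.2 ⟨hu, ht⟩
    have h1 : M.form (N u t) (tang M a b F (u, t)) = 0 := by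
      rw [tang, M.form_smul_right, ← hF.velocity_eq hab hu ht, hN.orthogonal u hu t ht, mul_zero]
    have h2 := hF.eq_form_smul_nrm hab hp (hN.tangent u hu t ht) h1
    have h3 := hN.unit u hu t ht
    rw [h2, M.form_smul_left, M.form_smul_right, hF.form_nrm_nrm hab hp] at h3
    rw [← h3]; ring
  have hcont : ContinuousOn φ (Icc a b) := by
    have h1 := continuousOn_pi.1 (hN.continuousOn t ht)
    have h2 := continuousOn_pi.1 ((hF.smooth_nrm hab).continuousOn_slice ht)
    simp only [hφ, SpaceForm.form_eq]
    exact ((continuousOn_const.mul ((h1 0).mul (h2 0))).add ((h1 1).mul (h2 1))).add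
      ((h1 2).mul (h2 2))
  rcases isPreconnected_Icc.eq_one_or_eq_neg_one_of_sq_eq hcont (fun u hu => hsq u hu) with h | h
  · exact ⟨1, by simp, fun u hu => by rw [hcurv u hu, h hu]; rfl⟩
  · exact ⟨-1, by simp, fun u hu => by rw [hcurv u hu, h hu]; rfl⟩

end IsGlobalSolution

end Frame

end DirichletCSF

theorem mainTheorem6 (M : DirichletCSF.SpaceForm) (a b : ℝ) (hab : a < b) (A B : Fin 3 → ℝ)
    (F : ℝ → ℝ → Fin 3 → ℝ) (hF : DirichletCSF.IsGlobalSolution M a b A B F)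
    (N : ℝ → ℝ → Fin 3 → ℝ) (hN : DirichletCSF.IsUnitNormal M a b F N) (n : ℕ) :
    TendstoUniformlyOn
      (fun t u => (DirichletCSF.arcDeriv M a b F t)^[n] (DirichletCSF.curvature M a b F N t) u)
      (fun _ => (0 : ℝ)) atTop (Icc a b) := by
  rw [Metric.tendstoUniformlyOn_iff]
  intro ε hε
  filter_upwards [(hF.curvatureFlow hab).eventually_abs_curvDeriv_lt n hε,
    eventually_gt_atTop 0] with t ht ht0 u hu
  -- The sign may change with `t`, as the given normal is continuous only along each curve; only
  -- `|c| = 1` matters.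
  obtain ⟨c, hc, hcurv⟩ := hF.exists_curvature_eq hab hN ht0
  rw [hF.iterate_arcDeriv hab ht0 hcurv n u hu, dist_comm, Real.dist_0_eq_abs, abs_mul, hc,
    one_mul]
  exact ht u hu
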